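/- **Setting.** A function $f:[0,\infty)\to[0,\infty)$ is of class $\mathcal K$ if it is continuous, strictly increasing and $f(0)=0$; of class $\mathcal K_\infty$ if moreover it is unbounded. $\beta:[0,\infty)^2\to[0,\infty)$ is of class $\mathcal{KL}$ if $\beta(\cdot,t)$ is of class $\mathcal K$ for every $t$ and $\beta(s,\cdot)$ is nonincreasing with limit $0$ for every $s$. Write $|\cdot|_S$ for the (Euclidean) distance to a set $S$, $u(t)=\sin(2\pi t)$, and for $h:\mathbb R\to\mathbb R$, $\delta>0$ $$y_\delta(x,t)=h(x+\delta u(t)),\quad a_{0,\delta}(x)=2\int_0^1 y_\delta(x,t)\,dt,\quad b_{1,\delta}(x)=2\int_0^1 y_\delta(x,t)\sin(2\pi t)\,dt .$$ *Assumption 1.* $h$ is smooth and $h(x)>h(x^\star)$ for all $x\neq x^\star$. *Assumption 2.* $m:\mathbb R\to\mathbb R$ is locally Lipschitz and strictly quasi-convex (if $m(x)<m(y)$ and $0<\theta<1$ then $m(\theta x+(1-\theta)y)<m(y)$), $\alpha$ is of class $\mathcal K_\infty$, $A\ge 0$, $m-A\le h\le m+A$, and $|m(x_2)-m(x_1)|\ge\alpha(|x_2-x_1|)$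 whenever $(x_1-x^\star)(x_2-x^\star)\ge0$. Put $\underline\delta^\star(s)=2\int_0^{1/2}\alpha(s\sin(2\pi t))\,dt$. The extremum seeking scheme with high-pass filter is $$\dot x=-\gamma\,(y_\delta(x,t)-\bar y)\,u(t),\qquad \dot{\bar y}=\gamma\,(y_\delta(x,t)-\bar y),\qquad x(0)=x_0,\ \bar y(0)=\bar y_0, \tag{1}$$ and its average system is $$\dot x_a=-\gamma\, b_{1,\delta}(x_a)/2,\tag{2a}$$ $$\dot{\bar y}_a=-\gamma\,\bar y_a+\gamma\, a_{0,\delta}(x_a)/2.\tag{2b}$$ An *averaged attractor with estimates $(\beta,\beta_g)$* is a pair $(\mathcal A_\delta,\tau)$ of a nonempty compact set $\mathcal A_\delta\subseteq[x^\star-\delta,x^\star+\delta]$ and a continuous $\tau:\mathbb R\to\mathbb R$ such that, for every $\gamma>0$, solutions of (2a) and of (2a)–(2b) exist on $[0,\infty)$ from every initial state and satisfy, for all $t\ge0$, $$|x_a(t)|_{\mathcal A_\delta}\le\beta(|x_a(0)|_{\mathcal A_\delta},\gamma t),\qquad \|(x_a,\bar y_a)(t)\|_{G}\le\beta_g(\|(x_a,\bar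 y_a)(0)\|_{G},\gamma t),$$ where $G=\mathrm{graph}\,\tau|_{\mathcal A_\delta}=\{(x,\tau(x)):x\in\mathcal A_\delta\}$. Here $\beta,\beta_g$ are of class $\mathcal{KL}$ and $\beta(\cdot,0)$ is of class $\mathcal K_\infty$; $\chi$ denotes the inverse of $\beta(\cdot,0)$. **Theorem 1.** Let $r,\delta,d>0$ satisfy $r-d-2\delta>0$. (i) If $h,x^\star,m,\alpha,A$ satisfy Assumptions 1–2 and $\underline\delta^\star(\delta)\ge A+\bar b$ for some $\bar b>0$, then an averaged attractor $(\mathcal A_\delta,\tau)$ exists, with some estimates $(\beta,\beta_g)$. (ii) Let $L_r>0$ and estimates $\beta,\beta_g$ be given, and put $r_0=\chi(r-d-2\delta)$. There exist $\bar t>0$ and $\gamma^\star>0$, depending only on $r,\delta,d,L_r$ and on the estimates $\beta,\beta_g$ for the average systems (in particular not on a bound $M_r$ of $|h|$ on $[x^\star-r,x^\star+r]$), such that the following holds for all $h,x^\star,m,\alpha,A$ satisfying Assumptions 1–2 with $\underline\delta^\star(\delta)\ge A+\bar b$ for some $\bar b>0$ and $|h(x_1)-h(x_2)|\le L_r|x_1-x_2|$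 on $[x^\star-r,x^\star+r]$, and for every averaged attractor $(\mathcal A_\delta,\tau)$ with estimates $(\beta,\beta_g)$: for every $\gamma\in(0,\gamma^\star)$ and all $(x_0,\bar y_0)$ with $|x_0-x^\star|\le r_0$ and $|\bar y_0-a_{0,\delta}(x_0)/2|\le\gamma^\star$, the system (1) has a solution on $[0,\infty)$, and every such solution is bounded and satisfies $$\|(x(t),\bar y(t))\|_{\mathrm{graph}\,\tau|_{\mathcal A_\delta}}\le d\qquad\text{for all } t\ge \bar t/\gamma .$$ -/

import Mathlib

open Set Filter Topology
open scoped ContDiff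

namespace ExtremumSeeking

noncomputable section

/-! ### Comparison functions -/

/-- Class `K`: continuous and strictly increasing on `[0, ∞)`, vanishing at `0`. -/
structure IsClassK (f : ℝ → ℝ) : Prop where
  continuousOn : ContinuousOn f (Ici 0)
  strictMonoOn : StrictMonoOn f (Ici 0)
  map_zero : f 0 = 0

/-- Class `K∞`: class `K` and unbounded. -/
structure IsClassKInfty (f : ℝ → ℝ) : Prop extends IsClassK f where
  tendsto_atTop : Tendsto f atTop atTop

/-- Class `KL`: class `K` in the first argument, nonincreasing to `0` in the second one. -/
structure IsClassKL (β : ℝ → ℝ → ℝ) : Prop where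
  classK : ∀ t, 0 ≤ t → IsClassK (fun s => β s t)
  antitoneOn : ∀ s, 0 ≤ s → AntitoneOn (β s) (Ici 0)
  tendsto_zero : ∀ s, 0 ≤ s → Tendsto (β s) atTop (𝓝 0)

/-- `χ = β⁻¹(·, 0)`, the inverse on `[0, ∞)` of `s ↦ β(s, 0)` (which is of class `K∞` below). -/
def chi (β : ℝ → ℝ → ℝ) (s : ℝ) : ℝ := Function.invFunOn (fun s' => β s' 0) (Ici 0) s

/-! ### The cost function -/

/-- `h` is smooth and `xs` is its strict global minimiser. -/
structure SmoothWithStrictMinimiser (h : ℝ → ℝ) (xs : ℝ) : Prop where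
  smooth : ContDiff ℝ ∞ h
  lt : ∀ x, x ≠ xs → 0 < h x - h xs

/-- Strict quasi-convexity (in the sense of Karamardian) on the real line. -/
def StrictlyQuasiConvex (m : ℝ → ℝ) : Prop :=
  ∀ x y, m x < m y → ∀ θ, 0 < θ → θ < 1 → m (θ * x + (1 - θ) * y) < m y

/-- `h` is within `A` of a locally Lipschitz, strictly quasi-convex `m` whose variation on either
side of `xs` is at least `α`. -/
structure HasQuasiConvexEnvelope (h : ℝ → ℝ) (xs : ℝ) (m α : ℝ → ℝ) (A : ℝ) : Prop where
  nonneg : 0 ≤ A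
  locallyLipschitz : LocallyLipschitz m
  strictlyQuasiConvex : StrictlyQuasiConvex m
  classKInfty : IsClassKInfty α
  lower : ∀ x, m x - A ≤ h x
  upper : ∀ x, h x ≤ m x + A
  variation : ∀ x₁ x₂, 0 ≤ (x₁ - xs) * (x₂ - xs) → α |x₂ - x₁| ≤ |m x₂ - m x₁|

/-- The function `s ↦ 2 ∫₀^{1/2} α (s sin (2πt)) dt`. -/
def deltaStar (α : ℝ → ℝ) (s : ℝ) : ℝ :=
  2 * ∫ t in (0 : ℝ)..(1 / 2), α (s * Real.sin (2 * Real.pi * t))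

/-! ### The scheme and its averages -/

/-- The dither signal. -/
def dither (t : ℝ) : ℝ := Real.sin (2 * Real.pi * t)

/-- The measured output `y_δ(x, t) = h (x + δ u(t))`. -/
def output (h : ℝ → ℝ) (δ x t : ℝ) : ℝ := h (x + δ * dither t)

/-- Fourier cosine coefficients of `t ↦ y_δ(x, t)`. -/
def cosCoeff (h : ℝ → ℝ) (δ : ℝ) (k : ℕ) (x : ℝ) : ℝ :=
  2 * ∫ t in (0 : ℝ)..1, output h δ x t * Real.cos (k * (2 * Real.pi) * t)

/-- Fourier sine coefficients of `t ↦ y_δ(x, t)`. -/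
def sinCoeff (h : ℝ → ℝ) (δ : ℝ) (k : ℕ) (x : ℝ) : ℝ :=
  2 * ∫ t in (0 : ℝ)..1, output h δ x t * Real.sin (k * (2 * Real.pi) * t)

/-- `(x, y)` is a trajectory on `[0, ∞)` of the extremum seeking scheme with high-pass filter. -/
def IsHPFTrajectory (h : ℝ → ℝ) (δ γ : ℝ) (x y : ℝ → ℝ) : Prop :=
  ∀ t, 0 ≤ t →
    HasDerivWithinAt x (-γ * (output h δ (x t) t - y t) * dither t) (Ici 0) t ∧
    HasDerivWithinAt y (γ * (output h δ (x t) t - y t)) (Ici 0) t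

/-- `x` is a trajectory on `[0, ∞)` of the scalar average system. -/
def IsAvgTrajectory (h : ℝ → ℝ) (δ γ : ℝ) (x : ℝ → ℝ) : Prop :=
  ∀ t, 0 ≤ t → HasDerivWithinAt x (-γ * (sinCoeff h δ 1 (x t) / 2)) (Ici 0) t

/-- `(x, y)` is a trajectory on `[0, ∞)` of the average of the scheme with high-pass filter. -/
def IsHPFAvgTrajectory (h : ℝ → ℝ) (δ γ : ℝ) (x y : ℝ → ℝ) : Prop :=
  IsAvgTrajectory h δ γ x ∧
  ∀ t, 0 ≤ t → HasDerivWithinAt y (-γ * y t + γ * (cosCoeff h δ 0 (x t) / 2)) (Ici 0) t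

/-- The graph of `τ` restricted to `S`, in the Euclidean plane. -/
def graphOver (τ : ℝ → ℝ) (S : Set ℝ) : Set (EuclideanSpace ℝ (Fin 2)) :=
  {p | p 0 ∈ S ∧ p 1 = τ (p 0)}

/-- `S` is globally asymptotically stable for the scalar average system, with estimate `β`. -/
def AvgGASWith (h : ℝ → ℝ) (δ : ℝ) (S : Set ℝ) (β : ℝ → ℝ → ℝ) : Prop :=
  ∀ γ, 0 < γ →
    (∀ x₀, ∃ x, IsAvgTrajectory h δ γ x ∧ x 0 = x₀) ∧
    ∀ x, IsAvgTrajectory h δ γ x → ∀ t, 0 ≤ t →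
      Metric.infDist (x t) S ≤ β (Metric.infDist (x 0) S) (γ * t)

/-- `G` is globally asymptotically stable for the average of the scheme with high-pass filter,
with estimate `β`. -/
def HPFAvgGASWith (h : ℝ → ℝ) (δ : ℝ) (G : Set (EuclideanSpace ℝ (Fin 2)))
    (β : ℝ → ℝ → ℝ) : Prop :=
  ∀ γ, 0 < γ →
    (∀ x₀ y₀, ∃ x y, IsHPFAvgTrajectory h δ γ x y ∧ x 0 = x₀ ∧ y 0 = y₀) ∧
    ∀ x y, IsHPFAvgTrajectory h δ γ x y → ∀ t, 0 ≤ t →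
      Metric.infDist !₂[x t, y t] G ≤ β (Metric.infDist !₂[x 0, y 0] G) (γ * t)

/-- The compact set `S` near the minimiser is globally asymptotically stable for the scalar
average system, and the graph of the continuous function `τ` over `S` is so for the average of the
scheme with high-pass filter, with the estimates `β` and `βg`. -/
structure IsAvgAttractor (h : ℝ → ℝ) (xs δ : ℝ) (S : Set ℝ) (τ : ℝ → ℝ)
    (β βg : ℝ → ℝ → ℝ) : Prop where
  isCompact : IsCompact S
  nonempty : S.Nonempty
  subset : S ⊆ Icc (xs - δ) (xs + δ)
  continuous : Continuous τ
  gas : AvgGASWith h δ S β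
  graph_gas : HPFAvgGASWith h δ (graphOver τ S) βg

end

end ExtremumSeeking

/-!
Write `g x = ∫₀¹ h (x + δ u) u` and `a x = ∫₀¹ h (x + δ u)` for the averaged fields, `u` being the
dither.

**Sign of `g`.** As `m` increases by at least `α s` on each of `[x - s, x]` and `[x, x + s]` when
`x ≥ xs + δ`, Chebyshev's integral inequality turns `A + b ≤ deltaStar α δ` into `g x ≥ 2 b / π`
there, and symmetrically on the left (`HasQuasiConvexEnvelope.pointsInward`). Hence every interval
around `xs` of radius at least `δ` is forward invariant for the scalar average system, and `g`
vanishes somewhere in `[xs - δ, xs + δ]`.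

**Existence of an attractor** (`PointsInward.exists_isAvgAttractor`). Take
`S = [xs - δ, xs + δ]`, which is entered at speed at least `2 b / π`, and let `τ x` be the response
of the filter to the full backward orbit of `x` under the scalar average system truncated outside
`S` (`exists_invariant_graph`). In the strip over `S` the quantity `y - τ x` decays exactly like
`exp (-t)`, and before entering the strip the trajectory moves at bounded speed for a time
proportional to its initial distance to the graph. The resulting bound depends on that distance
through the modulus of continuity of `τ`, and is dominated by a class `K` function
(`exists_classK_majorant`).

**Practical stability** (`practical_stability`). For a globally Lipschitz cost, the moving average
over one period of a trajectory of the scheme solves the average system up to an error `O(γ²)`, so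
by Grönwall's inequality it follows over times `O(1 / γ)` the average trajectory issued from the
same state (`IsHPFTrajectory.abs_sub_average_le`). The constants involve only the Lipschitz constant
and a bound of `h (x + δ u) - y`, which is at most `2 L r + 1`: this is why no bound on `|h|` enters.
The trajectory is first built for the cost truncated outside `[xs - r, xs + r]`. Comparison
restarted every `T₁ / γ` units of time confines it to the region where the truncation is inactive,
because the average trajectories contract to near `S` by the estimate `β` and meanwhile do not leave
a given interval around `xs`. Comparison started at time `t - T / γ`, for any `t ≥ T / γ`, then gives
the distance to the graph by `βg`; the initial distance to the graph is bounded uniformly, since the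
graph contains the equilibria of the average system. Uniqueness transfers the conclusion to every
trajectory.
-/

namespace ExtremumSeeking

open scoped NNReal

/-! ### Ordinary differential equations on a half-line -/

section ODE

variable {E : Type*} [NormedAddCommGroup E] [NormedSpace ℝ E]

lemma continuousOn_of_hasDerivWithinAt {x v : ℝ → E}
    (hx : ∀ t, 0 ≤ t → HasDerivWithinAt x (v t) (Ici 0) t) : ContinuousOn x (Ici 0) :=
  fun t ht => (hx t ht).continuousWithinAt

lemma hasDerivWithinAt_Ici_self {x : ℝ → E} {v : E} {t : ℝ} (ht : 0 ≤ t)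
    (hx : HasDerivWithinAt x v (Ici 0) t) : HasDerivWithinAt x v (Ici t) t :=
  hx.mono (Ici_subset_Ici.2 ht)

lemma hasDerivWithinAt_comp_const_add {x : ℝ → E} {v : E} {s t : ℝ} (hs : 0 ≤ s)
    (hx : HasDerivWithinAt x v (Ici 0) (s + t)) :
    HasDerivWithinAt (fun t => x (s + t)) v (Ici 0) t := by
  have h1 : HasDerivWithinAt (fun t => s + t) (1 : ℝ) (Ici 0) t :=
    ((hasDerivAt_id t).const_add s).hasDerivWithinAt
  have h2 : MapsTo (fun t => s + t) (Ici (0 : ℝ)) (Ici 0) := fun t ht => add_nonneg hs ht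
  simpa [Function.comp_def] using hx.scomp t h1 h2

/-- A vector field that is globally Lipschitz in the state, continuous in time and bounded has a
solution on `[0, ∞)` from every initial state. The Picard–Lindelöf solutions on `[0, n]` agree
where they overlap, by uniqueness. -/
lemma exists_solution_of_bounded_lipschitz [CompleteSpace E] {f : ℝ → E → E} {C K : ℝ≥0}
    (hK : ∀ t, LipschitzWith K (f t)) (hc : ∀ x, Continuous fun t => f t x)
    (hC : ∀ t x, ‖f t x‖ ≤ C) (x₀ : E) :
    ∃ α : ℝ → E, α 0 = x₀ ∧ ∀ t, 0 ≤ t → HasDerivWithinAt α (f t (α t)) (Ici 0) t := by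
  have key : ∀ n : ℕ, ∃ α : ℝ → E, α 0 = x₀ ∧
      ∀ t ∈ Icc (0 : ℝ) n, HasDerivWithinAt α (f t (α t)) (Icc 0 n) t := by
    intro n
    have hn : (0 : ℝ) ∈ Icc (0 : ℝ) n := ⟨le_rfl, n.cast_nonneg⟩
    have hp : IsPicardLindelof f (⟨0, hn⟩ : Icc (0 : ℝ) n) x₀ (C * n) 0 C K :=
      { lipschitzOnWith := fun t _ => (hK t).lipschitzOnWith
        continuousOn := fun x _ => (hc x).continuousOn
        norm_le := fun t _ x _ => hC t x
        mul_max_le := by simp }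
    exact hp.exists_eq_forall_mem_Icc_hasDerivWithinAt₀
  choose α h0 hα using key
  have hderiv : ∀ n : ℕ, ∀ t ∈ Ico (0 : ℝ) n,
      HasDerivWithinAt (α n) (f t (α n t)) (Ici 0) t := by
    intro n t ht
    refine (hα n t (Ico_subset_Icc_self ht)).mono_of_mem_nhdsWithin ?_
    have : Ici (0 : ℝ) ∩ Iio n ∈ 𝓝[Ici 0] t :=
      inter_mem_nhdsWithin _ (Iio_mem_nhds ht.2)
    exact mem_of_superset this fun s hs => ⟨hs.1, hs.2.le⟩
  have agree : ∀ m n : ℕ, m ≤ n → EqOn (α m) (α n) (Icc 0 m) := by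
    intro m n hmn
    have hsub : Icc (0 : ℝ) m ⊆ Icc 0 n := Icc_subset_Icc_right (Nat.cast_le.2 hmn)
    refine ODE_solution_unique_of_mem_Icc_right (v := f) (s := fun _ => univ) (K := K)
      (fun t _ => (hK t).lipschitzOnWith)
      (fun t ht => (hα m t ht).continuousWithinAt)
      (fun t ht => hasDerivWithinAt_Ici_self ht.1 (hderiv m t ht)) (fun _ _ => mem_univ _)
      (fun t ht => ((hα n t (hsub ht)).mono hsub).continuousWithinAt)
      (fun t ht => hasDerivWithinAt_Ici_self ht.1
        (hderiv n t ⟨ht.1, ht.2.trans_le (Nat.cast_le.2 hmn)⟩)) (fun _ _ => mem_univ _)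
      (by rw [h0, h0])
  refine ⟨fun t => α (⌈t⌉₊ + 1) t, by simpa using h0 1, fun t ht => ?_⟩
  have hlt : ∀ s : ℝ, s < (⌈s⌉₊ + 1 : ℕ) := fun s =>
    (Nat.le_ceil s).trans_lt (by push_cast; linarith)
  have heq : (fun s => α (⌈s⌉₊ + 1) s) =ᶠ[𝓝[Ici 0] t] α (⌈t⌉₊ + 1) := by
    have : Ici (0 : ℝ) ∩ Iio ((⌈t⌉₊ + 1 : ℕ) : ℝ) ∈ 𝓝[Ici 0] t :=
      inter_mem_nhdsWithin _ (Iio_mem_nhds (hlt t))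
    filter_upwards [this] with s hs
    rcases le_total (⌈s⌉₊ + 1) (⌈t⌉₊ + 1) with h | h
    · exact agree _ _ h ⟨hs.1, (hlt s).le⟩
    · exact (agree _ _ h ⟨hs.1, le_of_lt hs.2⟩).symm
  exact (hderiv _ t ⟨ht, hlt t⟩).congr_of_eventuallyEq heq rfl

/-- Two solutions on `[0, ∞)` of a globally Lipschitz equation with the same initial state
coincide. -/
lemma solution_unique_of_lipschitz {f : ℝ → E → E} {K : ℝ≥0}
    (hK : ∀ t, LipschitzWith K (f t)) {α β : ℝ → E}
    (hα : ∀ t, 0 ≤ t → HasDerivWithinAt α (f t (α t)) (Ici 0) t)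
    (hβ : ∀ t, 0 ≤ t → HasDerivWithinAt β (f t (β t)) (Ici 0) t) (h0 : α 0 = β 0) {t : ℝ}
    (ht : 0 ≤ t) : α t = β t :=
  ODE_solution_unique_of_mem_Icc_right (v := f) (s := fun _ => univ) (a := 0) (b := t)
    (fun t _ => (hK t).lipschitzOnWith)
    ((continuousOn_of_hasDerivWithinAt hα).mono Icc_subset_Ici_self)
    (fun t ht => hasDerivWithinAt_Ici_self ht.1 (hα t ht.1)) (fun _ _ => mem_univ _)
    ((continuousOn_of_hasDerivWithinAt hβ).mono Icc_subset_Ici_self)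
    (fun t ht => hasDerivWithinAt_Ici_self ht.1 (hβ t ht.1)) (fun _ _ => mem_univ _) h0 ⟨ht, le_rfl⟩

end ODE

/-- A barrier descending at speed `k`: a trajectory starting below it stays below, provided its
velocity on the barrier is less than `-k`. -/
lemma le_sub_mul_of_deriv_lt {x v : ℝ → ℝ} {a b c k : ℝ} (ha : 0 ≤ a)
    (hx : ∀ t, 0 ≤ t → HasDerivWithinAt x (v t) (Ici 0) t) (hxa : x a ≤ c)
    (hv : ∀ t ∈ Ico a b, x t = c - k * (t - a) → v t < -k) {t : ℝ} (ht : t ∈ Icc a b) :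
    x t ≤ c - k * (t - a) := by
  refine image_le_of_deriv_right_lt_deriv_boundary (f := x) (f' := v) (B' := fun _ => -k)
    ((continuousOn_of_hasDerivWithinAt hx).mono fun s hs => ha.trans hs.1)
    (fun s hs => hasDerivWithinAt_Ici_self (ha.trans hs.1) (hx s (ha.trans hs.1)))
    (by simpa using hxa) (fun s => ?_) hv ht
  simpa using (((hasDerivAt_id s).sub_const a).const_mul k).const_sub c

/-- A trajectory cannot cross a level `c` upwards if its velocity at that level is negative. -/
lemma le_of_deriv_neg {x v : ℝ → ℝ} {a c : ℝ} (ha : 0 ≤ a)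
    (hx : ∀ t, 0 ≤ t → HasDerivWithinAt x (v t) (Ici 0) t) (hxa : x a ≤ c)
    (hv : ∀ t, a ≤ t → x t = c → v t < 0) {t : ℝ} (ht : a ≤ t) : x t ≤ c := by
  simpa using le_sub_mul_of_deriv_lt (k := 0) (b := t) ha hx hxa
    (fun s hs h => by simpa using hv s hs.1 (by simpa using h)) ⟨ht, le_rfl⟩

/-- The mirror image of `le_of_deriv_neg`. -/
lemma ge_of_deriv_pos {x v : ℝ → ℝ} {a c : ℝ} (ha : 0 ≤ a)
    (hx : ∀ t, 0 ≤ t → HasDerivWithinAt x (v t) (Ici 0) t) (hxa : c ≤ x a)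
    (hv : ∀ t, a ≤ t → x t = c → 0 < v t) {t : ℝ} (ht : a ≤ t) : c ≤ x t := by
  have := le_of_deriv_neg (x := fun t => -x t) (v := fun t => -v t) (c := -c) ha
    (fun t ht => (hx t ht).neg) (neg_le_neg hxa)
    (fun t ht h => neg_lt_zero.2 (hv t ht (neg_inj.1 h))) ht
  exact neg_le_neg_iff.1 this

/-! ### The averaged vector field -/

lemma continuous_dither : Continuous dither := by unfold dither; fun_prop

lemma abs_dither_le (t : ℝ) : |dither t| ≤ 1 := Real.abs_sin_le_one _

lemma dither_add_one (t : ℝ) : dither (t + 1) = dither t := by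
  unfold dither
  rw [mul_add, mul_one, Real.sin_add_two_pi]

lemma dither_add_half (t : ℝ) : dither (t + 1 / 2) = -dither t := by
  unfold dither
  rw [show 2 * Real.pi * (t + 1 / 2) = 2 * Real.pi * t + Real.pi by ring, Real.sin_add_pi]

lemma dither_nonneg {t : ℝ} (ht : t ∈ Icc (0 : ℝ) (1 / 2)) : 0 ≤ dither t := by
  refine Real.sin_nonneg_of_nonneg_of_le_pi (by have := ht.1; positivity) ?_
  nlinarith [ht.2, Real.pi_pos]

lemma abs_mul_dither_le {δ : ℝ} (hδ : 0 ≤ δ) (t : ℝ) : |δ * dither t| ≤ δ := by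
  rw [abs_mul, abs_of_nonneg hδ]
  exact mul_le_of_le_one_right hδ (abs_dither_le t)

lemma integral_dither_half : ∫ t in (0 : ℝ)..(1 / 2), dither t = 1 / Real.pi := by
  have h : ∀ t, HasDerivAt (fun t => -Real.cos (2 * Real.pi * t) / (2 * Real.pi)) (dither t) t := by
    intro t
    have h1 : HasDerivAt (fun t : ℝ => 2 * Real.pi * t) (2 * Real.pi) t := by
      simpa using (hasDerivAt_id t).const_mul (2 * Real.pi)
    refine ((h1.cos.neg).div_const (2 * Real.pi)).congr_deriv ?_
    rw [dither]
    field_simp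
  rw [intervalIntegral.integral_eq_sub_of_hasDerivAt (fun t _ => h t)
    (continuous_dither.intervalIntegrable _ _)]
  rw [show 2 * Real.pi * (1 / 2) = Real.pi by ring]
  simp only [Real.cos_pi, mul_zero, Real.cos_zero]
  field_simp
  norm_num

lemma continuous_output {h : ℝ → ℝ} (hh : Continuous h) (δ x : ℝ) :
    Continuous fun t => h (x + δ * dither t) := by
  have := continuous_dither
  fun_prop

lemma sinCoeff_one_div_two (h : ℝ → ℝ) (δ x : ℝ) :
    sinCoeff h δ 1 x / 2 = ∫ t in (0 : ℝ)..1, h (x + δ * dither t) * dither t := by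
  simp only [sinCoeff, output, dither, Nat.cast_one, one_mul]
  ring

lemma cosCoeff_zero_div_two (h : ℝ → ℝ) (δ x : ℝ) :
    cosCoeff h δ 0 x / 2 = ∫ t in (0 : ℝ)..1, h (x + δ * dither t) := by
  simp only [cosCoeff, output, dither, Nat.cast_zero, zero_mul, Real.cos_zero, mul_one]
  ring

/-- Integrals of `1`-periodic functions over a unit interval, in the form used to compare the
scheme with its average over one period of the dither. -/
lemma integral_unit_eq {f : ℝ → ℝ} (hf : ∀ t, f (t + 1) = f t) (t : ℝ) :
    ∫ s in t..(t + 1), f s = ∫ s in (0 : ℝ)..1, f s := by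
  simpa using (show Function.Periodic f 1 from hf).intervalIntegral_add_eq t 0

lemma abs_integral_sub_le {f g : ℝ → ℝ} {a c : ℝ} (hf : ContinuousOn f (Icc a (a + 1)))
    (hg : ContinuousOn g (Icc a (a + 1))) (hfg : ∀ t ∈ Icc a (a + 1), |f t - g t| ≤ c) :
    |(∫ t in a..(a + 1), f t) - ∫ t in a..(a + 1), g t| ≤ c := by
  have ha : a ≤ a + 1 := by linarith
  rw [← intervalIntegral.integral_sub (hf.intervalIntegrable_of_Icc ha)
    (hg.intervalIntegrable_of_Icc ha)]
  have := intervalIntegral.norm_integral_le_of_norm_le_const (a := a) (b := a + 1) (C := c)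
    (f := fun t => f t - g t) (fun t ht => by
      rw [uIoc_of_le ha] at ht
      exact hfg t (Ioc_subset_Icc_self ht))
  simpa using this

section Lipschitz

variable {h : ℝ → ℝ} {δ L a b x y : ℝ}

lemma abs_sinCoeff_sub_le (hh : Continuous h) (hδ : 0 ≤ δ)
    (hl : ∀ x ∈ Icc (a - δ) (b + δ), ∀ y ∈ Icc (a - δ) (b + δ), |h x - h y| ≤ L * |x - y|)
    (hx : x ∈ Icc a b) (hy : y ∈ Icc a b) :
    |sinCoeff h δ 1 x / 2 - sinCoeff h δ 1 y / 2| ≤ L * |x - y| := by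
  rw [sinCoeff_one_div_two, sinCoeff_one_div_two]
  have := abs_integral_sub_le (a := 0) (c := L * |x - y|)
    ((continuous_output hh δ x).mul continuous_dither).continuousOn
    ((continuous_output hh δ y).mul continuous_dither).continuousOn
    (fun t _ => by
      have h1 := abs_le.1 (abs_mul_dither_le hδ t)
      simp only [Pi.mul_apply]
      rw [← sub_mul, abs_mul]
      refine (mul_le_of_le_one_right (abs_nonneg _) (abs_dither_le t)).trans ?_
      simpa using hl (x + δ * dither t) ⟨by linarith [hx.1], by linarith [hx.2]⟩
        (y + δ * dither t) ⟨by linarith [hy.1], by linarith [hy.2]⟩)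
  simpa using this

lemma abs_cosCoeff_sub_le (hh : Continuous h) (hδ : 0 ≤ δ)
    (hl : ∀ x ∈ Icc (a - δ) (b + δ), ∀ y ∈ Icc (a - δ) (b + δ), |h x - h y| ≤ L * |x - y|)
    (hx : x ∈ Icc a b) (hy : y ∈ Icc a b) :
    |cosCoeff h δ 0 x / 2 - cosCoeff h δ 0 y / 2| ≤ L * |x - y| := by
  rw [cosCoeff_zero_div_two, cosCoeff_zero_div_two]
  have := abs_integral_sub_le (a := 0) (c := L * |x - y|)
    (continuous_output hh δ x).continuousOn (continuous_output hh δ y).continuousOn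
    (fun t _ => by
      have h1 := abs_le.1 (abs_mul_dither_le hδ t)
      simpa using hl (x + δ * dither t) ⟨by linarith [hx.1], by linarith [hx.2]⟩
        (y + δ * dither t) ⟨by linarith [hy.1], by linarith [hy.2]⟩)
  simpa using this

/-- The average of `h` around `x` is close to any value `c` that is close to `h` there. -/
lemma abs_cosCoeff_sub_const_le {c K : ℝ} (hh : Continuous h)
    (hc : ∀ t, |h (x + δ * dither t) - c| ≤ K) : |cosCoeff h δ 0 x / 2 - c| ≤ K := by
  rw [cosCoeff_zero_div_two]
  have := abs_integral_sub_le (a := 0) (c := K) (continuous_output hh δ x).continuousOn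
    (continuousOn_const (c := c)) (fun t _ => hc t)
  simpa using this

lemma continuous_sinCoeff_one (hh : Continuous h) (δ : ℝ) :
    Continuous fun x => sinCoeff h δ 1 x / 2 := by
  simp_rw [sinCoeff_one_div_two]
  have := continuous_dither
  fun_prop

lemma continuous_cosCoeff_zero (hh : Continuous h) (δ : ℝ) :
    Continuous fun x => cosCoeff h δ 0 x / 2 := by
  simp_rw [cosCoeff_zero_div_two]
  have := continuous_dither
  fun_prop

end Lipschitz

/-! ### The sign of the averaged vector field away from the minimiser -/

/-- The averaged field as a weighted integral of symmetric differences of `h`. -/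
lemma sinCoeff_one_eq_integral_half {h : ℝ → ℝ} (hh : Continuous h) (δ x : ℝ) :
    sinCoeff h δ 1 x / 2 =
      ∫ t in (0 : ℝ)..(1 / 2), (h (x + δ * dither t) - h (x - δ * dither t)) * dither t := by
  have hc : Continuous fun t => h (x + δ * dither t) * dither t :=
    (continuous_output hh δ x).mul continuous_dither
  have hc' : Continuous fun t => h (x - δ * dither t) * dither t := by
    have := continuous_dither
    fun_prop
  have h2 : ∫ t in (1 / 2 : ℝ)..1, h (x + δ * dither t) * dither t =
      ∫ t in (0 : ℝ)..(1 / 2), -(h (x - δ * dither t) * dither t) := by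
    have := intervalIntegral.integral_comp_add_right (a := 0) (b := 1 / 2)
      (fun t => h (x + δ * dither t) * dither t) (1 / 2)
    rw [show (0 : ℝ) + 1 / 2 = 1 / 2 by norm_num, show (1 / 2 : ℝ) + 1 / 2 = 1 by norm_num] at this
    rw [← this]
    refine intervalIntegral.integral_congr fun t _ => ?_
    simp only [dither_add_half]
    rw [mul_neg, mul_neg, ← sub_eq_add_neg]
  rw [sinCoeff_one_div_two, ← intervalIntegral.integral_add_adjacent_intervals
    (hc.intervalIntegrable 0 (1 / 2)) (hc.intervalIntegrable (1 / 2) 1), h2,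
    intervalIntegral.integral_neg, ← sub_eq_add_neg,
    ← intervalIntegral.integral_sub (hc.intervalIntegrable _ _) (hc'.intervalIntegrable _ _)]
  refine intervalIntegral.integral_congr fun t _ => ?_
  ring

/-- Chebyshev's integral inequality for the nondecreasing functions `α (δ s)` and `s` of
`s = sin (2πt)`, whose mean over a half-period is `2 / π`. -/
lemma deltaStar_le_integral {α : ℝ → ℝ} {δ : ℝ} (hα : IsClassK α) (hδ : 0 ≤ δ) :
    deltaStar α δ / Real.pi ≤ ∫ t in (0 : ℝ)..(1 / 2), α (δ * dither t) * dither t := by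
  have hcont : ContinuousOn (fun t => α (δ * dither t)) (Icc 0 (1 / 2)) := by
    refine hα.continuousOn.comp (by have := continuous_dither; fun_prop) fun t ht => ?_
    exact mul_nonneg hδ (dither_nonneg ht)
  have h0 : (0 : ℝ) ≤ 1 / 2 := by norm_num
  have hpi := Real.pi_pos
  have hpos : 0 ≤ ∫ t in (0 : ℝ)..(1 / 2),
      (α (δ * dither t) - α (δ * (2 / Real.pi))) * (dither t - 2 / Real.pi) := by
    refine intervalIntegral.integral_nonneg h0 fun t ht => ?_
    have hd := mul_nonneg hδ (dither_nonneg ht)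
    have hm : 0 ≤ δ * (2 / Real.pi) := by positivity
    rcases le_total (dither t) (2 / Real.pi) with hle | hle
    · refine mul_nonneg_of_nonpos_of_nonpos (sub_nonpos.2 ?_) (sub_nonpos.2 hle)
      exact hα.strictMonoOn.monotoneOn hd hm (mul_le_mul_of_nonneg_left hle hδ)
    · refine mul_nonneg (sub_nonneg.2 ?_) (sub_nonneg.2 hle)
      exact hα.strictMonoOn.monotoneOn hm hd (mul_le_mul_of_nonneg_left hle hδ)
  have hi1 : IntervalIntegrable (fun t => α (δ * dither t) * dither t) MeasureTheory.volume
      0 (1 / 2) := (hcont.mul continuous_dither.continuousOn).intervalIntegrable_of_Icc h0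
  have hi2 : IntervalIntegrable (fun t => 2 / Real.pi * α (δ * dither t)) MeasureTheory.volume
      0 (1 / 2) := (continuousOn_const.mul hcont).intervalIntegrable_of_Icc h0
  have hi3 : IntervalIntegrable (fun t => α (δ * (2 / Real.pi)) * (dither t - 2 / Real.pi))
      MeasureTheory.volume 0 (1 / 2) :=
    (continuous_const.mul (continuous_dither.sub continuous_const)).intervalIntegrable _ _
  have hsplit : (fun t => (α (δ * dither t) - α (δ * (2 / Real.pi))) * (dither t - 2 / Real.pi)) =
      fun t => (α (δ * dither t) * dither t - 2 / Real.pi * α (δ * dither t))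
        - α (δ * (2 / Real.pi)) * (dither t - 2 / Real.pi) := by
    ext t; ring
  rw [hsplit, intervalIntegral.integral_sub (hi1.sub hi2) hi3, intervalIntegral.integral_sub hi1 hi2,
    intervalIntegral.integral_const_mul, intervalIntegral.integral_const_mul,
    intervalIntegral.integral_sub (continuous_dither.intervalIntegrable _ _) (by simp),
    integral_dither_half, intervalIntegral.integral_const] at hpos
  have hz : 1 / Real.pi - (1 / 2 - 0 : ℝ) • (2 / Real.pi) = 0 := by
    simp only [smul_eq_mul]; field_simp; norm_num
  rw [hz, mul_zero, sub_zero, sub_nonneg] at hpos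
  refine le_trans (le_of_eq ?_) hpos
  unfold deltaStar dither
  ring

lemma le_sinCoeff_of_symmetric_difference {h α : ℝ → ℝ} {δ A b x : ℝ} (hh : Continuous h)
    (hα : IsClassK α) (hδ : 0 ≤ δ) (hb : A + b ≤ deltaStar α δ)
    (hx : ∀ s, 0 ≤ s → s ≤ δ → 2 * α s - 2 * A ≤ h (x + s) - h (x - s)) :
    2 * b / Real.pi ≤ sinCoeff h δ 1 x / 2 := by
  have h0 : (0 : ℝ) ≤ 1 / 2 := by norm_num
  have hcont : ContinuousOn (fun t => α (δ * dither t)) (Icc 0 (1 / 2)) := by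
    refine hα.continuousOn.comp (by have := continuous_dither; fun_prop) fun t ht => ?_
    exact mul_nonneg hδ (dither_nonneg ht)
  have hi1 : IntervalIntegrable (fun t => α (δ * dither t) * dither t) MeasureTheory.volume
      0 (1 / 2) := (hcont.mul continuous_dither.continuousOn).intervalIntegrable_of_Icc h0
  have hi2 : IntervalIntegrable dither MeasureTheory.volume 0 (1 / 2) :=
    continuous_dither.intervalIntegrable _ _
  have hle : ∫ t in (0 : ℝ)..(1 / 2), (2 * (α (δ * dither t) * dither t) - 2 * A * dither t) ≤
      sinCoeff h δ 1 x / 2 := by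
    rw [sinCoeff_one_eq_integral_half hh]
    refine intervalIntegral.integral_mono_on h0 ((hi1.const_mul 2).sub (hi2.const_mul (2 * A)))
      (Continuous.intervalIntegrable ?_ _ _) fun t ht => ?_
    · have := continuous_dither
      fun_prop
    · have hd := dither_nonneg ht
      have := hx (δ * dither t) (mul_nonneg hδ hd)
        (mul_le_of_le_one_right hδ ((le_abs_self _).trans (abs_dither_le t)))
      nlinarith [mul_le_mul_of_nonneg_right this hd]
  rw [intervalIntegral.integral_sub (hi1.const_mul 2) (hi2.const_mul (2 * A)),
    intervalIntegral.integral_const_mul, intervalIntegral.integral_const_mul,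
    integral_dither_half] at hle
  have hc := deltaStar_le_integral hα hδ
  have hb' : (A + b) / Real.pi ≤ deltaStar α δ / Real.pi :=
    div_le_div_of_nonneg_right hb Real.pi_pos.le
  calc 2 * b / Real.pi = 2 * ((A + b) / Real.pi) - 2 * A * (1 / Real.pi) := by ring
    _ ≤ _ := by linarith

/-- A continuous function on `[0, ∞)` that is bounded below and varies by at least `α` is
increasing, with increments at least `α`. -/
lemma le_sub_of_variation {n α : ℝ → ℝ} {c : ℝ} (hn : Continuous n) (hα : IsClassKInfty α)
    (hc : ∀ s, c ≤ n s) (hv : ∀ s t, 0 ≤ s → 0 ≤ t → α |t - s| ≤ |n t - n s|) {s t : ℝ}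
    (hs : 0 ≤ s) (hst : s ≤ t) : α (t - s) ≤ n t - n s := by
  obtain ⟨z, hz, htz⟩ : ∃ z, n 0 - c < α z ∧ t ≤ z :=
    ((hα.tendsto_atTop.eventually_gt_atTop _).and (eventually_ge_atTop t)).exists
  have hz0 : 0 ≤ z := (hs.trans hst).trans htz
  have hvz := hv 0 z le_rfl hz0
  rw [sub_zero, abs_of_nonneg hz0] at hvz
  have h0z : n 0 ≤ n z := by
    by_contra! hlt
    rw [abs_of_neg (sub_neg.2 hlt)] at hvz
    linarith [hc z]
  have hinj : InjOn n (Icc 0 z) := by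
    intro x hx y hy hxy
    by_contra hne
    have h1 := hv x y hx.1 hy.1
    rw [hxy, sub_self, abs_zero] at h1
    have h2 := hα.strictMonoOn (mem_Ici.2 le_rfl) (mem_Ici.2 (abs_nonneg (y - x)))
      (abs_pos.2 (sub_ne_zero.2 (Ne.symm hne)))
    rw [hα.map_zero] at h2
    exact absurd h1 (not_le.2 h2)
  have hmono := (hn.continuousOn (s := Icc 0 z)).strictMonoOn_of_injOn_Icc hz0 h0z hinj
  have hle := hmono.monotoneOn ⟨hs, hst.trans htz⟩ ⟨hs.trans hst, htz⟩ hst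
  have := hv s t hs (hs.trans hst)
  rwa [abs_of_nonneg (sub_nonneg.2 hst), abs_of_nonneg (sub_nonneg.2 hle)] at this

section Sign

variable {h : ℝ → ℝ} {xs : ℝ} {m α : ℝ → ℝ} {A b δ : ℝ}

lemma SmoothWithStrictMinimiser.le (hh : SmoothWithStrictMinimiser h xs) (x : ℝ) :
    h xs ≤ h x := by
  rcases eq_or_ne x xs with rfl | hx
  · exact le_rfl
  · linarith [hh.lt x hx]

/-- To the right of `xs + δ` the averaged field points left, at a speed bounded below: `m`
increases there, by at least `α (s)` on each of `[x - s, x]` and `[x, x + s]`. -/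
lemma le_sinCoeff_one (hh : SmoothWithStrictMinimiser h xs)
    (hm : HasQuasiConvexEnvelope h xs m α A) (hδ : 0 ≤ δ) (hb : A + b ≤ deltaStar α δ) {x : ℝ}
    (hx : xs + δ ≤ x) : 2 * b / Real.pi ≤ sinCoeff h δ 1 x / 2 := by
  refine le_sinCoeff_of_symmetric_difference hh.smooth.continuous hm.classKInfty.toIsClassK hδ hb
    fun s hs hsδ => ?_
  have key : ∀ s t, 0 ≤ s → s ≤ t → α (t - s) ≤ m (xs + t) - m (xs + s) := by
    intro s t hs hst
    refine le_sub_of_variation (n := fun s => m (xs + s)) (c := h xs - A)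
      (hm.locallyLipschitz.continuous.comp (continuous_const.add continuous_id)) hm.classKInfty
      (fun s => ?_) (fun s t hs ht => ?_) hs hst
    · linarith [hm.upper (xs + s), hh.le (xs + s)]
    · simpa using hm.variation (xs + s) (xs + t) (by simpa using mul_nonneg hs ht)
  have h1 := key (x - xs) (x - xs + s) (by linarith) (by linarith)
  have h2 := key (x - xs - s) (x - xs) (by linarith) (by linarith)
  rw [show xs + (x - xs + s) = x + s by ring, show xs + (x - xs) = x by ring,
    show x - xs + s - (x - xs) = s by ring] at h1
  rw [show xs + (x - xs - s) = x - s by ring, show xs + (x - xs) = x by ring,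
    show x - xs - (x - xs - s) = s by ring] at h2
  linarith [hm.lower (x + s), hm.upper (x - s)]

/-- The mirror image of `le_sinCoeff_one`. -/
lemma sinCoeff_one_le (hh : SmoothWithStrictMinimiser h xs)
    (hm : HasQuasiConvexEnvelope h xs m α A) (hδ : 0 ≤ δ) (hb : A + b ≤ deltaStar α δ) {x : ℝ}
    (hx : x ≤ xs - δ) : sinCoeff h δ 1 x / 2 ≤ -(2 * b / Real.pi) := by
  have hneg : sinCoeff (fun x => -h x) δ 1 x / 2 = -(sinCoeff h δ 1 x / 2) := by
    rw [sinCoeff_one_div_two, sinCoeff_one_div_two, ← intervalIntegral.integral_neg]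
    refine intervalIntegral.integral_congr fun t _ => ?_
    simp only [neg_mul]
  rw [le_neg, ← hneg]
  refine le_sinCoeff_of_symmetric_difference hh.smooth.continuous.neg hm.classKInfty.toIsClassK
    hδ hb fun s hs hsδ => ?_
  have key : ∀ s t, 0 ≤ s → s ≤ t → α (t - s) ≤ m (xs - t) - m (xs - s) := by
    intro s t hs hst
    refine le_sub_of_variation (n := fun s => m (xs - s)) (c := h xs - A)
      (hm.locallyLipschitz.continuous.comp (continuous_const.sub continuous_id)) hm.classKInfty
      (fun s => ?_) (fun s t hs ht => ?_) hs hst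
    · linarith [hm.upper (xs - s), hh.le (xs - s)]
    · have := hm.variation (xs - s) (xs - t) (by nlinarith [mul_nonneg hs ht])
      rwa [show xs - t - (xs - s) = -(t - s) by ring, abs_neg] at this
  have h1 := key (xs - x) (xs - x + s) (by linarith) (by linarith)
  have h2 := key (xs - x - s) (xs - x) (by linarith) (by linarith)
  rw [show xs - (xs - x + s) = x - s by ring, show xs - (xs - x) = x by ring,
    show xs - x + s - (xs - x) = s by ring] at h1
  rw [show xs - (xs - x - s) = x + s by ring, show xs - (xs - x) = x by ring,
    show xs - x - (xs - x - s) = s by ring] at h2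
  linarith [hm.lower (x - s), hm.upper (x + s)]

end Sign

/-! ### Averaging on finite time intervals -/

lemma hasDerivAt_movingAverage {f : ℝ → ℝ} (hf : Continuous f) (t : ℝ) :
    HasDerivAt (fun t => ∫ s in t..(t + 1), f s) (f (t + 1) - f t) t := by
  have h1 : ∀ t, HasDerivAt (fun t => ∫ s in (0 : ℝ)..t, f s) (f t) t := fun t =>
    (hf.integral_hasStrictDerivAt 0 t).hasDerivAt
  have h2 : HasDerivAt (fun t => ∫ s in (0 : ℝ)..(t + 1), f s) (f (t + 1)) t := by
    simpa using (h1 (t + 1)).comp_add_const t 1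
  refine (h2.sub (h1 t)).congr_of_eventuallyEq (Eventually.of_forall fun s => ?_)
  exact (intervalIntegral.integral_interval_sub_left (hf.intervalIntegrable _ _)
    (hf.intervalIntegrable _ _)).symm

lemma abs_sub_le_of_deriv_le {x v : ℝ → ℝ} {C s t : ℝ}
    (hx : ∀ t, 0 ≤ t → HasDerivWithinAt x (v t) (Ici 0) t) (hv : ∀ t, 0 ≤ t → |v t| ≤ C)
    (hs : 0 ≤ s) (ht : 0 ≤ t) : |x t - x s| ≤ C * |t - s| :=
  (convex_Ici 0).norm_image_sub_le_of_norm_hasDerivWithin_le (fun t ht => hx t ht) hv hs ht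

lemma integral_unit_deriv {x v : ℝ → ℝ} {t : ℝ}
    (hx : ∀ t, 0 ≤ t → HasDerivWithinAt x (v t) (Ici 0) t) (hv : ContinuousOn v (Ici 0))
    (ht : 0 ≤ t) : ∫ s in t..(t + 1), v s = x (t + 1) - x t := by
  have hle : t ≤ t + 1 := by linarith
  have hsub : Icc t (t + 1) ⊆ Ici 0 := fun s hs => ht.trans hs.1
  refine intervalIntegral.integral_eq_sub_of_hasDeriv_right_of_le hle
    ((continuousOn_of_hasDerivWithinAt hx).mono hsub) (fun s hs => ?_)
    ((hv.mono hsub).intervalIntegrable_of_Icc hle)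
  have hs0 : 0 ≤ s := ht.trans hs.1.le
  exact (hx s hs0).mono fun u hu => hs0.trans (le_of_lt hu)

section Averaging

variable {H : ℝ → ℝ} {δ γ L M : ℝ} {x y : ℝ → ℝ}

lemma IsHPFTrajectory.continuousOn_fst (h : IsHPFTrajectory H δ γ x y) :
    ContinuousOn x (Ici 0) := fun t ht => (h t ht).1.continuousWithinAt

lemma IsHPFTrajectory.continuousOn_snd (h : IsHPFTrajectory H δ γ x y) :
    ContinuousOn y (Ici 0) := fun t ht => (h t ht).2.continuousWithinAt

lemma IsHPFTrajectory.continuousOn_output (h : IsHPFTrajectory H δ γ x y) (hH : Continuous H) :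
    ContinuousOn (fun t => output H δ (x t) t) (Ici 0) :=
  hH.comp_continuousOn
    (h.continuousOn_fst.add (continuous_const.mul continuous_dither).continuousOn)

lemma IsHPFTrajectory.abs_fst_sub_le (h : IsHPFTrajectory H δ γ x y) (hγ : 0 ≤ γ)
    (hM : ∀ t, 0 ≤ t → |output H δ (x t) t - y t| ≤ M) {s t : ℝ} (hs : 0 ≤ s) (ht : 0 ≤ t) :
    |x t - x s| ≤ γ * M * |t - s| := by
  refine abs_sub_le_of_deriv_le (fun t ht => (h t ht).1) (fun t ht => ?_) hs ht
  rw [abs_mul, abs_mul, abs_neg, abs_of_nonneg hγ]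
  exact (mul_le_of_le_one_right (by positivity) (abs_dither_le t)).trans
    (mul_le_mul_of_nonneg_left (hM t ht) hγ)

lemma IsHPFTrajectory.abs_snd_sub_le (h : IsHPFTrajectory H δ γ x y) (hγ : 0 ≤ γ)
    (hM : ∀ t, 0 ≤ t → |output H δ (x t) t - y t| ≤ M) {s t : ℝ} (hs : 0 ≤ s) (ht : 0 ≤ t) :
    |y t - y s| ≤ γ * M * |t - s| := by
  refine abs_sub_le_of_deriv_le (fun t ht => (h t ht).2) (fun t ht => ?_) hs ht
  rw [abs_mul, abs_of_nonneg hγ]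
  exact mul_le_mul_of_nonneg_left (hM t ht) hγ

/-- The moving average over one period of the dither stays close to a slow signal. -/
lemma abs_movingAverage_sub_le {x : ℝ → ℝ} {C : ℝ} (hx : ContinuousOn x (Ici 0))
    (hC : ∀ s t, 0 ≤ s → 0 ≤ t → |x t - x s| ≤ C * |t - s|) (hC0 : 0 ≤ C) {s t : ℝ} (ht : 0 ≤ t)
    (hs : s ∈ Icc t (t + 1)) : |(∫ u in t..(t + 1), x (max u 0)) - x s| ≤ C := by
  have hs0 : 0 ≤ s := ht.trans hs.1
  have hcont : Continuous fun u => x (max u 0) :=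
    hx.comp_continuous (by fun_prop) fun u => le_max_right u 0
  have := abs_integral_sub_le (a := t) (c := C) hcont.continuousOn
    (continuousOn_const (c := x s)) (fun u hu => by
      have hu0 : 0 ≤ u := ht.trans hu.1
      rw [max_eq_left hu0]
      refine (hC s u hs0 hu0).trans (mul_le_of_le_one_right hC0 ?_)
      rw [abs_le]
      constructor <;> linarith [hu.1, hu.2, hs.1, hs.2])
  simpa using this

/-- The moving average of the first component solves the averaged equation up to an error of
order `γ ^ 2`. -/
lemma IsHPFTrajectory.abs_fst_defect_le (h : IsHPFTrajectory H δ γ x y) (hγ : 0 ≤ γ) (hL : 0 ≤ L)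
    (hM0 : 0 ≤ M) (hc : Continuous H) (hH : ∀ u v, |H u - H v| ≤ L * |u - v|)
    (hM : ∀ t, 0 ≤ t → |output H δ (x t) t - y t| ≤ M) {t : ℝ} (ht : 0 ≤ t) :
    |x (t + 1) - x t - -γ * (sinCoeff H δ 1 (∫ u in t..(t + 1), x (max u 0)) / 2)| ≤
      γ ^ 2 * M * (L + 1) := by
  set X := ∫ u in t..(t + 1), x (max u 0) with hX
  have hsub : Icc t (t + 1) ⊆ Ici 0 := fun s hs => ht.trans hs.1
  have hd := continuous_dither.continuousOn (s := Icc t (t + 1))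
  have hzero : ∫ s in t..(t + 1), dither s = 0 := by
    rw [integral_unit_eq dither_add_one, ← intervalIntegral.integral_add_adjacent_intervals
      (b := 1 / 2) (continuous_dither.intervalIntegrable _ _)
      (continuous_dither.intervalIntegrable _ _)]
    have := intervalIntegral.integral_comp_add_right (a := 0) (b := 1 / 2) dither (1 / 2)
    rw [show (0 : ℝ) + 1 / 2 = 1 / 2 by norm_num, show (1 / 2 : ℝ) + 1 / 2 = 1 by norm_num] at this
    rw [← this]
    simp only [dither_add_half, intervalIntegral.integral_neg]
    ring
  have h1 : x (t + 1) - x t =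
      ∫ s in t..(t + 1), -γ * (output H δ (x s) s - y s) * dither s :=
    (integral_unit_deriv (fun t ht => (h t ht).1) ((continuousOn_const.mul
      ((h.continuousOn_output hc).sub h.continuousOn_snd)).mul continuous_dither.continuousOn)
      ht).symm
  -- Subtracting the constant `y t` costs nothing, as the dither has mean zero.
  have h2 : -γ * (sinCoeff H δ 1 X / 2) =
      ∫ s in t..(t + 1), -γ * (H (X + δ * dither s) - y t) * dither s := by
    have hi : IntervalIntegrable (fun s => H (X + δ * dither s) * dither s) MeasureTheory.volume
        t (t + 1) := ((continuous_output hc δ X).mul continuous_dither).intervalIntegrable _ _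
    have hi2 : IntervalIntegrable (fun s => y t * dither s) MeasureTheory.volume t (t + 1) :=
      (continuous_const.mul continuous_dither).intervalIntegrable _ _
    have he : (fun s => -γ * (H (X + δ * dither s) - y t) * dither s) =
        fun s => -γ * (H (X + δ * dither s) * dither s - y t * dither s) := by
      ext s; ring
    rw [he, intervalIntegral.integral_const_mul, intervalIntegral.integral_sub hi hi2,
      intervalIntegral.integral_const_mul, hzero, mul_zero, sub_zero, sinCoeff_one_div_two]
    congr 1
    exact (integral_unit_eq (f := fun s => H (X + δ * dither s) * dither s)
      (fun s => by simp only [dither_add_one]) t).symm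
  rw [h1, h2]
  refine abs_integral_sub_le
    (((continuousOn_const.mul ((h.continuousOn_output hc).sub h.continuousOn_snd)).mul
      continuous_dither.continuousOn).mono hsub)
    (((continuousOn_const.mul ((continuous_output hc δ X).continuousOn.sub
      continuousOn_const)).mul hd)) fun s hs => ?_
  have hs0 : 0 ≤ s := ht.trans hs.1
  have hxs := abs_movingAverage_sub_le h.continuousOn_fst
    (fun s t hs ht => h.abs_fst_sub_le hγ hM hs ht) (mul_nonneg hγ hM0) ht hs
  have hys : |y t - y s| ≤ γ * M := by
    refine (h.abs_snd_sub_le hγ hM hs0 ht).trans (mul_le_of_le_one_right (by positivity) ?_)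
    rw [abs_le]
    constructor <;> linarith [hs.1, hs.2]
  have hHs : |H (x s + δ * dither s) - H (X + δ * dither s)| ≤ L * (γ * M) := by
    refine (hH _ _).trans (mul_le_mul_of_nonneg_left ?_ hL)
    rw [show x s + δ * dither s - (X + δ * dither s) = -(X - x s) by ring, abs_neg]
    exact hxs
  have hfac : -γ * (output H δ (x s) s - y s) * dither s
      - -γ * (H (X + δ * dither s) - y t) * dither s =
      -γ * ((H (x s + δ * dither s) - H (X + δ * dither s)) + (y t - y s)) * dither s := by
    simp only [output]; ring
  rw [hfac, abs_mul, abs_mul, abs_neg, abs_of_nonneg hγ]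
  calc γ * |(H (x s + δ * dither s) - H (X + δ * dither s)) + (y t - y s)| * |dither s|
      ≤ γ * |(H (x s + δ * dither s) - H (X + δ * dither s)) + (y t - y s)| :=
        mul_le_of_le_one_right (by positivity) (abs_dither_le s)
    _ ≤ γ * (L * (γ * M) + γ * M) :=
        mul_le_mul_of_nonneg_left ((abs_add_le _ _).trans (add_le_add hHs hys)) hγ
    _ = γ ^ 2 * M * (L + 1) := by ring

/-- The moving average of the second component solves the averaged equation up to an error of
order `γ ^ 2`. -/
lemma IsHPFTrajectory.abs_snd_defect_le (h : IsHPFTrajectory H δ γ x y) (hγ : 0 ≤ γ) (hL : 0 ≤ L)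
    (hM0 : 0 ≤ M) (hc : Continuous H) (hH : ∀ u v, |H u - H v| ≤ L * |u - v|)
    (hM : ∀ t, 0 ≤ t → |output H δ (x t) t - y t| ≤ M) {t : ℝ} (ht : 0 ≤ t) :
    |y (t + 1) - y t - (-γ * (∫ u in t..(t + 1), y (max u 0)) +
      γ * (cosCoeff H δ 0 (∫ u in t..(t + 1), x (max u 0)) / 2))| ≤ γ ^ 2 * M * (L + 1) := by
  set X := ∫ u in t..(t + 1), x (max u 0) with hX
  have hsub : Icc t (t + 1) ⊆ Ici 0 := fun s hs => ht.trans hs.1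
  have hle : t ≤ t + 1 := by linarith
  have h1 : y (t + 1) - y t = ∫ s in t..(t + 1), γ * (output H δ (x s) s - y s) :=
    (integral_unit_deriv (fun t ht => (h t ht).2) (continuousOn_const.mul
      ((h.continuousOn_output hc).sub h.continuousOn_snd)) ht).symm
  have hY : ∫ u in t..(t + 1), y (max u 0) = ∫ u in t..(t + 1), y u := by
    refine intervalIntegral.integral_congr fun u hu => ?_
    rw [uIcc_of_le hle] at hu
    rw [max_eq_left (ht.trans hu.1)]
  have h2 : -γ * (∫ u in t..(t + 1), y (max u 0)) + γ * (cosCoeff H δ 0 X / 2) =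
      ∫ s in t..(t + 1), γ * (H (X + δ * dither s) - y s) := by
    rw [hY, intervalIntegral.integral_const_mul, intervalIntegral.integral_sub
      ((continuous_output hc δ X).intervalIntegrable _ _)
      ((h.continuousOn_snd.mono hsub).intervalIntegrable_of_Icc hle), cosCoeff_zero_div_two,
      integral_unit_eq (f := fun s => H (X + δ * dither s))
        (fun s => by simp only [dither_add_one]) t]
    ring
  rw [h1, h2]
  refine abs_integral_sub_le
    ((continuousOn_const.mul ((h.continuousOn_output hc).sub h.continuousOn_snd)).mono hsub)
    (continuousOn_const.mul ((continuous_output hc δ X).continuousOn.sub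
      (h.continuousOn_snd.mono hsub))) fun s hs => ?_
  have hxs := abs_movingAverage_sub_le h.continuousOn_fst
    (fun s t hs ht => h.abs_fst_sub_le hγ hM hs ht) (mul_nonneg hγ hM0) ht hs
  have hHs : |H (x s + δ * dither s) - H (X + δ * dither s)| ≤ L * (γ * M) := by
    refine (hH _ _).trans (mul_le_mul_of_nonneg_left ?_ hL)
    rw [show x s + δ * dither s - (X + δ * dither s) = -(X - x s) by ring, abs_neg]
    exact hxs
  have hfac : γ * (output H δ (x s) s - y s) - γ * (H (X + δ * dither s) - y s) =
      γ * (H (x s + δ * dither s) - H (X + δ * dither s)) := by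
    simp only [output]; ring
  rw [hfac, abs_mul, abs_of_nonneg hγ]
  calc γ * |H (x s + δ * dither s) - H (X + δ * dither s)| ≤ γ * (L * (γ * M)) :=
        mul_le_mul_of_nonneg_left hHs hγ
    _ ≤ γ ^ 2 * M * (L + 1) := by nlinarith [mul_nonneg (sq_nonneg γ) hM0]

/-- **Averaging on a finite time interval.** For a globally Lipschitz cost, a trajectory of the
scheme stays within `O(γ)` of the average trajectory issued from the same state, over times of
order `1 / γ`. The constant depends only on the Lipschitz constant and on a bound of the filtered
output. -/
lemma IsHPFTrajectory.abs_sub_average_le (h : IsHPFTrajectory H δ γ x y) (hδ : 0 ≤ δ)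
    (hγ : 0 < γ) (hL : 0 ≤ L) (hM0 : 0 ≤ M) (hH : ∀ u v, |H u - H v| ≤ L * |u - v|)
    (hM : ∀ t, 0 ≤ t → |output H δ (x t) t - y t| ≤ M) {xa ya : ℝ → ℝ}
    (ha : IsHPFAvgTrajectory H δ γ xa ya) {t₁ t T : ℝ} (ht₁ : 0 ≤ t₁) (hx0 : xa 0 = x t₁)
    (hy0 : ya 0 = y t₁) (ht : 0 ≤ t) (htT : γ * t ≤ T) :
    |x (t₁ + t) - xa t| ≤ 3 * M * Real.exp ((L + 1) * T) * γ ∧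
      |y (t₁ + t) - ya t| ≤ 3 * M * Real.exp ((L + 1) * T) * γ := by
  have hc : Continuous H := by
    have : LipschitzWith (Real.toNNReal L) H := LipschitzWith.of_dist_le_mul fun u v => by
      rw [Real.coe_toNNReal L hL]; exact hH u v
    exact this.continuous
  have hxl : ∀ s t, 0 ≤ s → 0 ≤ t → |x t - x s| ≤ γ * M * |t - s| := fun s t hs ht =>
    h.abs_fst_sub_le hγ.le hM hs ht
  have hyl : ∀ s t, 0 ≤ s → 0 ≤ t → |y t - y s| ≤ γ * M * |t - s| := fun s t hs ht =>
    h.abs_snd_sub_le hγ.le hM hs ht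
  have hγM : 0 ≤ γ * M := mul_nonneg hγ.le hM0
  set X : ℝ → ℝ := fun t => ∫ u in t..(t + 1), x (max u 0) with hX
  set Y : ℝ → ℝ := fun t => ∫ u in t..(t + 1), y (max u 0) with hY
  have hXx : ∀ t, 0 ≤ t → |X t - x t| ≤ γ * M := fun t ht =>
    abs_movingAverage_sub_le h.continuousOn_fst hxl hγM ht ⟨le_rfl, by linarith⟩
  have hYy : ∀ t, 0 ≤ t → |Y t - y t| ≤ γ * M := fun t ht =>
    abs_movingAverage_sub_le h.continuousOn_snd hyl hγM ht ⟨le_rfl, by linarith⟩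
  have hder : ∀ {z : ℝ → ℝ}, ContinuousOn z (Ici 0) → ∀ s, 0 ≤ s →
      HasDerivAt (fun s => ∫ u in (t₁ + s)..(t₁ + s + 1), z (max u 0))
        (z (t₁ + s + 1) - z (t₁ + s)) s := by
    intro z hz s hs
    have hcont : Continuous fun u => z (max u 0) :=
      hz.comp_continuous (by fun_prop) fun u => le_max_right u 0
    have := (hasDerivAt_movingAverage hcont (t₁ + s)).comp_const_add t₁ s
    rwa [max_eq_left (by linarith), max_eq_left (by linarith)] at this
  let v : ℝ → ℝ × ℝ → ℝ × ℝ := fun _ p =>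
    (-γ * (sinCoeff H δ 1 p.1 / 2), -γ * p.2 + γ * (cosCoeff H δ 0 p.1 / 2))
  have hK0 : 0 ≤ γ * (L + 1) := by positivity
  have hv : ∀ t, LipschitzWith (Real.toNNReal (γ * (L + 1))) (v t) := by
    intro t
    refine LipschitzWith.of_dist_le_mul fun p q => ?_
    rw [Real.coe_toNNReal _ hK0]
    have hp1 : |p.1 - q.1| ≤ dist p q := le_max_left _ _
    have hp2 : |p.2 - q.2| ≤ dist p q := le_max_right _ _
    have hs := abs_sinCoeff_sub_le (h := H) (L := L) (a := min p.1 q.1) (b := max p.1 q.1) hc hδ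
      (fun u _ w _ => hH u w) ⟨min_le_left _ _, le_max_left _ _⟩ ⟨min_le_right _ _, le_max_right _ _⟩
    have hcs := abs_cosCoeff_sub_le (h := H) (L := L) (a := min p.1 q.1) (b := max p.1 q.1) hc hδ
      (fun u _ w _ => hH u w) ⟨min_le_left _ _, le_max_left _ _⟩ ⟨min_le_right _ _, le_max_right _ _⟩
    refine max_le ?_ ?_
    · simp only [v, Real.dist_eq]
      rw [← mul_sub, abs_mul, abs_neg, abs_of_pos hγ, mul_assoc]
      refine mul_le_mul_of_nonneg_left (hs.trans ?_) hγ.le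
      nlinarith [abs_nonneg (p.1 - q.1)]
    · simp only [v, Real.dist_eq]
      rw [show -γ * p.2 + γ * (cosCoeff H δ 0 p.1 / 2) - (-γ * q.2 + γ * (cosCoeff H δ 0 q.1 / 2)) =
        γ * ((cosCoeff H δ 0 p.1 / 2 - cosCoeff H δ 0 q.1 / 2) - (p.2 - q.2)) by ring,
        abs_mul, abs_of_pos hγ, mul_assoc]
      refine mul_le_mul_of_nonneg_left ((abs_sub _ _).trans ?_) hγ.le
      nlinarith
  have hgr := dist_le_of_approx_trajectories_ODE (v := v) (K := Real.toNNReal (γ * (L + 1)))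
    (f := fun s => (X (t₁ + s), Y (t₁ + s)))
    (f' := fun s => (x (t₁ + s + 1) - x (t₁ + s), y (t₁ + s + 1) - y (t₁ + s)))
    (g := fun s => (xa s, ya s)) (g' := fun s => v s (xa s, ya s)) (a := 0) (b := t)
    (δ := γ * M) (εf := γ ^ 2 * M * (L + 1)) (εg := 0) hv
    (fun s hs => ((hder h.continuousOn_fst s hs.1).continuousAt.prodMk
      (hder h.continuousOn_snd s hs.1).continuousAt).continuousWithinAt)
    (fun s hs => ((hder h.continuousOn_fst s hs.1).prodMk
      (hder h.continuousOn_snd s hs.1)).hasDerivWithinAt)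
    (fun s hs => max_le
      (h.abs_fst_defect_le hγ.le hL hM0 hc hH hM (add_nonneg ht₁ hs.1))
      (h.abs_snd_defect_le hγ.le hL hM0 hc hH hM (add_nonneg ht₁ hs.1)))
    (fun s hs => (((ha.1 s hs.1).continuousWithinAt).prodMk
      ((ha.2 s hs.1).continuousWithinAt)).mono Icc_subset_Ici_self)
    (fun s hs => (hasDerivWithinAt_Ici_self hs.1 (ha.1 s hs.1)).prodMk
      (hasDerivWithinAt_Ici_self hs.1 (ha.2 s hs.1)))
    (fun s _ => (dist_self _).le)
    (by
      simp only [add_zero, hx0, hy0]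
      exact max_le (hXx t₁ ht₁) (hYy t₁ ht₁)) t ⟨ht, le_rfl⟩
  have hbound : gronwallBound (γ * M) (Real.toNNReal (γ * (L + 1))) (γ ^ 2 * M * (L + 1) + 0)
      (t - 0) ≤ 2 * (γ * M) * Real.exp ((L + 1) * T) := by
    rw [Real.coe_toNNReal _ hK0, gronwallBound_of_K_ne_0 (by positivity)]
    have he : Real.exp (γ * (L + 1) * (t - 0)) ≤ Real.exp ((L + 1) * T) := by
      refine Real.exp_le_exp.2 ?_
      rw [sub_zero]
      nlinarith
    have hq : (γ ^ 2 * M * (L + 1) + 0) / (γ * (L + 1)) = γ * M := by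
      field_simp
      ring
    rw [hq]
    nlinarith [mul_le_mul_of_nonneg_left he hγM]
  have h1 : 1 ≤ Real.exp ((L + 1) * T) := by
    refine Real.one_le_exp (mul_nonneg (by linarith) (le_trans (by positivity) htT))
  have ht0 : 0 ≤ t₁ + t := add_nonneg ht₁ ht
  have hfin := hgr.trans hbound
  have hfx : |X (t₁ + t) - xa t| ≤ _ := (le_max_left _ _).trans hfin
  have hfy : |Y (t₁ + t) - ya t| ≤ _ := (le_max_right _ _).trans hfin
  have hM1 := mul_le_mul_of_nonneg_left h1 hγM
  constructor
  · have := abs_sub_le (x (t₁ + t)) (X (t₁ + t)) (xa t)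
    rw [abs_sub_comm (x (t₁ + t)) (X (t₁ + t))] at this
    nlinarith [hXx _ ht0]
  · have := abs_sub_le (y (t₁ + t)) (Y (t₁ + t)) (ya t)
    rw [abs_sub_comm (y (t₁ + t)) (Y (t₁ + t))] at this
    nlinarith [hYy _ ht0]

end Averaging

/-! ### Trajectories of the average system -/

/-- The averaged field points towards `[xs - δ, xs + δ]` from outside, at speed at least `c`. -/
structure PointsInward (h : ℝ → ℝ) (xs δ c : ℝ) : Prop where
  pos : 0 < c
  right : ∀ x, xs + δ ≤ x → c ≤ sinCoeff h δ 1 x / 2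
  left : ∀ x, x ≤ xs - δ → sinCoeff h δ 1 x / 2 ≤ -c

lemma HasQuasiConvexEnvelope.pointsInward {h : ℝ → ℝ} {xs : ℝ} {m α : ℝ → ℝ} {A b δ : ℝ}
    (hm : HasQuasiConvexEnvelope h xs m α A) (hh : SmoothWithStrictMinimiser h xs) (hδ : 0 ≤ δ)
    (hb0 : 0 < b) (hb : A + b ≤ deltaStar α δ) : PointsInward h xs δ (2 * b / Real.pi) where
  pos := by have := Real.pi_pos; positivity
  right _ hx := le_sinCoeff_one hh hm hδ hb hx
  left _ hx := sinCoeff_one_le hh hm hδ hb hx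

section Average

variable {h : ℝ → ℝ} {xs δ c γ : ℝ} {x y : ℝ → ℝ}

lemma IsAvgTrajectory.le_add (hx : IsAvgTrajectory h δ γ x) (hp : PointsInward h xs δ c)
    (hγ : 0 < γ) {ρ s t : ℝ} (hρ : δ ≤ ρ) (hs : 0 ≤ s) (h0 : x s ≤ xs + ρ) (ht : s ≤ t) :
    x t ≤ xs + ρ := by
  refine le_of_deriv_neg hs hx h0 (fun t _ h => ?_) ht
  have := hp.right (x t) (by linarith)
  nlinarith [hp.pos]

lemma IsAvgTrajectory.sub_le (hx : IsAvgTrajectory h δ γ x) (hp : PointsInward h xs δ c)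
    (hγ : 0 < γ) {ρ s t : ℝ} (hρ : δ ≤ ρ) (hs : 0 ≤ s) (h0 : xs - ρ ≤ x s) (ht : s ≤ t) :
    xs - ρ ≤ x t := by
  refine ge_of_deriv_pos hs hx h0 (fun t _ h => ?_) ht
  have := hp.left (x t) (by linarith)
  nlinarith [hp.pos]

/-- Every interval around `xs` of radius at least `δ` is forward invariant. -/
lemma IsAvgTrajectory.abs_sub_le (hx : IsAvgTrajectory h δ γ x) (hp : PointsInward h xs δ c)
    (hγ : 0 < γ) {ρ t : ℝ} (hρ : δ ≤ ρ) (h0 : |x 0 - xs| ≤ ρ) (ht : 0 ≤ t) : |x t - xs| ≤ ρ := by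
  rw [abs_le] at h0 ⊢
  constructor
  · linarith [hx.sub_le hp hγ hρ le_rfl (by linarith) ht]
  · linarith [hx.le_add hp hγ hρ le_rfl (by linarith) ht]

lemma PointsInward.exists_equilibrium (hp : PointsInward h xs δ c) (hh : Continuous h)
    (hδ : 0 ≤ δ) : ∃ xe ∈ Icc (xs - δ) (xs + δ), sinCoeff h δ 1 xe / 2 = 0 := by
  have h1 := hp.right _ le_rfl
  have h2 := hp.left _ le_rfl
  have h3 := hp.pos
  exact intermediate_value_Icc (by linarith) (continuous_sinCoeff_one hh δ).continuousOn
    ⟨by linarith, by linarith⟩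

/-- The average vector fields of two costs agree at `x` if the costs agree within `δ` of `x`. -/
lemma coeff_congr {H : ℝ → ℝ} {x : ℝ}
    (hH : ∀ t, H (x + δ * dither t) = h (x + δ * dither t)) :
    sinCoeff H δ 1 x = sinCoeff h δ 1 x ∧ cosCoeff H δ 0 x = cosCoeff h δ 0 x := by
  simp only [sinCoeff, cosCoeff, output, hH, and_self]

end Average

lemma isClosed_graphOver {τ : ℝ → ℝ} {S : Set ℝ} (hτ : Continuous τ) (hS : IsClosed S) :
    IsClosed (graphOver τ S) := by
  have h0 : Continuous fun p : EuclideanSpace ℝ (Fin 2) => p 0 := by fun_prop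
  have h1 : Continuous fun p : EuclideanSpace ℝ (Fin 2) => p 1 := by fun_prop
  exact (hS.preimage h0).inter (isClosed_eq h1 (hτ.comp h0))

lemma pair_mem_graphOver {τ : ℝ → ℝ} {S : Set ℝ} {x : ℝ} (hx : x ∈ S) :
    !₂[x, τ x] ∈ graphOver τ S := ⟨hx, rfl⟩

lemma dist_pair_le (a b a' b' : ℝ) : dist !₂[a, b] !₂[a', b'] ≤ |a - a'| + |b - b'| := by
  rw [EuclideanSpace.dist_eq, Real.sqrt_le_left (by positivity)]
  simp only [Fin.sum_univ_two, Real.dist_eq]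
  simp
  nlinarith [mul_nonneg (abs_nonneg (a - a')) (abs_nonneg (b - b')), sq_abs (a - a'),
    sq_abs (b - b')]

/-- The point over an equilibrium at which the filter is at rest too belongs to every averaged
attractor. -/
lemma IsAvgAttractor.equilibrium_mem {h : ℝ → ℝ} {xs δ : ℝ} {S : Set ℝ} {τ : ℝ → ℝ}
    {β βg : ℝ → ℝ → ℝ} (hS : IsAvgAttractor h xs δ S τ β βg) (hβg : IsClassKL βg) {xe : ℝ}
    (hxe : sinCoeff h δ 1 xe / 2 = 0) :
    xe ∈ S ∧ !₂[xe, cosCoeff h δ 0 xe / 2] ∈ graphOver τ S := by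
  set p : EuclideanSpace ℝ (Fin 2) := !₂[xe, cosCoeff h δ 0 xe / 2] with hp
  have htraj : IsHPFAvgTrajectory h δ 1 (fun _ => xe) (fun _ => cosCoeff h δ 0 xe / 2) := by
    refine ⟨fun t _ => ?_, fun t _ => ?_⟩
    · rw [hxe, mul_zero]
      exact hasDerivWithinAt_const _ _ _
    · rw [show -1 * (cosCoeff h δ 0 xe / 2) + 1 * (cosCoeff h δ 0 xe / 2) = 0 by ring]
      exact hasDerivWithinAt_const _ _ _
  have hle : ∀ t, 0 ≤ t → Metric.infDist p (graphOver τ S) ≤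
      βg (Metric.infDist p (graphOver τ S)) t := fun t ht => by
    simpa using (hS.graph_gas 1 one_pos).2 _ _ htraj t ht
  have hzero : Metric.infDist p (graphOver τ S) ≤ 0 :=
    ge_of_tendsto (hβg.tendsto_zero _ Metric.infDist_nonneg)
      ((eventually_ge_atTop 0).mono hle)
  obtain ⟨z, hz⟩ := hS.nonempty
  have hmem : p ∈ graphOver τ S :=
    ((isClosed_graphOver hS.continuous hS.isCompact.isClosed).mem_iff_infDist_zero
      ⟨_, pair_mem_graphOver hz⟩).2 (le_antisymm hzero Metric.infDist_nonneg)
  exact ⟨hmem.1, hmem⟩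

/-- An estimate `β` for an actual attractor satisfies `s ≤ β (s, 0)`. -/
lemma IsAvgAttractor.le_estimate {h : ℝ → ℝ} {xs δ : ℝ} {S : Set ℝ} {τ : ℝ → ℝ}
    {β βg : ℝ → ℝ → ℝ} (hS : IsAvgAttractor h xs δ S τ β βg) {s : ℝ} (hs : 0 ≤ s) :
    s ≤ β s 0 := by
  have hmax := hS.isCompact.sSup_mem hS.nonempty
  have hdist : Metric.infDist (sSup S + s) S = s := by
    refine le_antisymm ((Metric.infDist_le_dist_of_mem hmax).trans ?_) ?_
    · simp [abs_of_nonneg hs]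
    · refine (Metric.le_infDist hS.nonempty).2 fun z hz => ?_
      have := le_csSup hS.isCompact.bddAbove hz
      rw [Real.dist_eq]
      exact le_trans (by linarith) (le_abs_self _)
  obtain ⟨⟨x, hx, hx0⟩, -⟩ := (hS.gas 1 one_pos).imp_left fun h => h (sSup S + s)
  have := (hS.gas 1 one_pos).2 x hx 0 le_rfl
  rwa [hx0, hdist, mul_zero] at this

lemma IsClassKInfty.exists_eq {f : ℝ → ℝ} (hf : IsClassKInfty f) {s : ℝ} (hs : 0 ≤ s) :
    ∃ t ∈ Ici (0 : ℝ), f t = s := by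
  obtain ⟨z, hz, hz0⟩ := ((hf.tendsto_atTop.eventually_ge_atTop s).and
    (eventually_ge_atTop 0)).exists
  have := intermediate_value_Icc hz0 (hf.continuousOn.mono Icc_subset_Ici_self)
  obtain ⟨t, ht, hts⟩ := this ⟨by rwa [hf.map_zero], hz⟩
  exact ⟨t, ht.1, hts⟩

lemma chi_le {β : ℝ → ℝ → ℝ} (hβ : IsClassKInfty fun s => β s 0)
    (hle : ∀ s, 0 ≤ s → s ≤ β s 0) {s : ℝ} (hs : 0 ≤ s) : chi β s ≤ s := by
  have hex := hβ.exists_eq hs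
  have h1 : chi β s ∈ Ici (0 : ℝ) := Function.invFunOn_mem hex
  have h2 : β (chi β s) 0 = s := Function.invFunOn_eq hex
  exact (hle _ h1).trans h2.le

/-! ### Truncation -/

/-- The point of `[a, b]` nearest to `x`. -/
def clamp (a b x : ℝ) : ℝ := max a (min b x)

section Clamp

variable {a b x y : ℝ}

lemma clamp_mem (hab : a ≤ b) (x : ℝ) : clamp a b x ∈ Icc a b :=
  ⟨le_max_left _ _, max_le hab (min_le_left _ _)⟩

lemma clamp_of_mem (hx : x ∈ Icc a b) : clamp a b x = x := by
  rw [clamp, min_eq_right hx.2, max_eq_right hx.1]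

lemma abs_clamp_sub_le (a b x y : ℝ) : |clamp a b x - clamp a b y| ≤ |x - y| := by
  unfold clamp
  refine (abs_max_sub_max_le_max a (min b x) a (min b y)).trans (max_le (by simp) ?_)
  exact (abs_min_sub_min_le_max b x b y).trans (max_le (by simp) le_rfl)

lemma abs_sub_clamp_le {z : ℝ} (hz : z ∈ Icc a b) (x : ℝ) : |x - clamp a b x| ≤ |x - z| := by
  have hab : a ≤ b := hz.1.trans hz.2
  rcases le_total x a with h | h
  · rw [clamp, min_eq_right (h.trans hab), max_eq_left h, abs_of_nonpos (by linarith),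
      abs_of_nonpos (by linarith [hz.1])]
    linarith [hz.1]
  · rcases le_total x b with h' | h'
    · rw [clamp_of_mem ⟨h, h'⟩, sub_self, abs_zero]
      exact abs_nonneg _
    · rw [clamp, min_eq_left h', max_eq_right hab, abs_of_nonneg (by linarith),
        abs_of_nonneg (by linarith [hz.2])]
      linarith [hz.2]

lemma continuous_clamp (a b : ℝ) : Continuous (clamp a b) := by unfold clamp; fun_prop

lemma clamp_neg_of_neg (ha : a < 0) (hx : x < 0) : clamp a b x < 0 :=
  max_lt ha ((min_le_right _ _).trans_lt hx)

lemma clamp_pos_of_pos (hb : 0 < b) (hx : 0 < x) : 0 < clamp a b x :=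
  lt_max_of_lt_right (lt_min hb hx)

end Clamp

/-! ### Existence and uniqueness for the scheme -/

/-- For a bounded, globally Lipschitz cost the scheme has a global trajectory, along which the
filter state remains within `B + 1` of the centre `c` of the range of the cost. -/
lemma exists_IsHPFTrajectory {H : ℝ → ℝ} {δ γ L B c x₀ y₀ : ℝ} (hγ : 0 < γ) (hL : 0 ≤ L)
    (hB : 0 ≤ B) (hH : ∀ u v, |H u - H v| ≤ L * |u - v|) (hHB : ∀ u, |H u - c| ≤ B)
    (hy₀ : |y₀ - c| ≤ B + 1) :
    ∃ x y : ℝ → ℝ, IsHPFTrajectory H δ γ x y ∧ x 0 = x₀ ∧ y 0 = y₀ ∧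
      ∀ t, 0 ≤ t → |y t - c| ≤ B + 1 := by
  have hc : Continuous H := by
    have : LipschitzWith (Real.toNNReal L) H := LipschitzWith.of_dist_le_mul fun u v => by
      rw [Real.coe_toNNReal L hL]; exact hH u v
    exact this.continuous
  set M := 2 * B + 1 with hM
  have hM0 : 0 < M := by positivity
  -- The increment of the filter is truncated at a level that it turns out never to exceed.
  let q : ℝ → ℝ × ℝ → ℝ := fun t p => clamp (-M) M (H (p.1 + δ * dither t) - p.2)
  let f : ℝ → ℝ × ℝ → ℝ × ℝ := fun t p => (-γ * q t p * dither t, γ * q t p)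
  have hqM : ∀ t p, |q t p| ≤ M := fun t p =>
    abs_le.2 (clamp_mem (by linarith) (H (p.1 + δ * dither t) - p.2))
  have hql : ∀ t p p', |q t p - q t p'| ≤ (L + 1) * dist p p' := by
    intro t p p'
    have h1 : |p.1 - p'.1| ≤ dist p p' := le_max_left _ _
    have h2 : |p.2 - p'.2| ≤ dist p p' := le_max_right _ _
    have h3 := hH (p.1 + δ * dither t) (p'.1 + δ * dither t)
    rw [add_sub_add_right_eq_sub] at h3
    calc |q t p - q t p'| ≤ _ := abs_clamp_sub_le _ _ _ _
      _ = |(H (p.1 + δ * dither t) - H (p'.1 + δ * dither t)) - (p.2 - p'.2)| := by ring_nf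
      _ ≤ |H (p.1 + δ * dither t) - H (p'.1 + δ * dither t)| + |p.2 - p'.2| := abs_sub _ _
      _ ≤ L * dist p p' + dist p p' :=
          add_le_add (h3.trans (mul_le_mul_of_nonneg_left h1 hL)) h2
      _ = _ := by ring
  have hK0 : 0 ≤ γ * (L + 1) := by positivity
  have hγM : 0 ≤ γ * M := by positivity
  have hfl : ∀ t, LipschitzWith (Real.toNNReal (γ * (L + 1))) (f t) := by
    intro t
    refine LipschitzWith.of_dist_le_mul fun p p' => ?_
    rw [Real.coe_toNNReal _ hK0]
    have hq := mul_le_mul_of_nonneg_left (hql t p p') hγ.le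
    refine max_le ?_ ?_
    · simp only [f, Real.dist_eq]
      rw [← sub_mul, ← mul_sub, abs_mul, abs_mul, abs_neg, abs_of_pos hγ, mul_assoc γ (L + 1)]
      exact (mul_le_of_le_one_right (by positivity) (abs_dither_le t)).trans hq
    · simp only [f, Real.dist_eq]
      rw [← mul_sub, abs_mul, abs_of_pos hγ, mul_assoc]
      exact hq
  have hfc : ∀ p, Continuous fun t => f t p := by
    intro p
    have := continuous_dither
    have h2 := continuous_clamp (-M) M
    simp only [f, q]
    fun_prop
  have hfb : ∀ t p, ‖f t p‖ ≤ Real.toNNReal (γ * M) := by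
    intro t p
    rw [Real.coe_toNNReal _ hγM]
    have hq := mul_le_mul_of_nonneg_left (hqM t p) hγ.le
    refine max_le ?_ ?_
    · simp only [f, Real.norm_eq_abs]
      rw [abs_mul, abs_mul, abs_neg, abs_of_pos hγ]
      exact (mul_le_of_le_one_right (by positivity) (abs_dither_le t)).trans hq
    · simp only [f, Real.norm_eq_abs]
      rw [abs_mul, abs_of_pos hγ]
      exact hq
  obtain ⟨z, hz0, hz⟩ := exists_solution_of_bounded_lipschitz hfl hfc hfb (x₀, y₀)
  have hz1 : ∀ t, 0 ≤ t → HasDerivWithinAt (fun t => (z t).1) (f t (z t)).1 (Ici 0) t :=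
    fun t ht => (ContinuousLinearMap.fst ℝ ℝ ℝ).hasFDerivAt.comp_hasDerivWithinAt t (hz t ht)
  have hz2 : ∀ t, 0 ≤ t → HasDerivWithinAt (fun t => (z t).2) (f t (z t)).2 (Ici 0) t :=
    fun t ht => (ContinuousLinearMap.snd ℝ ℝ ℝ).hasFDerivAt.comp_hasDerivWithinAt t (hz t ht)
  have hyb : ∀ t, 0 ≤ t → |(z t).2 - c| ≤ B + 1 := by
    intro t ht
    rw [abs_le] at hy₀
    have hup := le_of_deriv_neg (c := c + (B + 1)) le_rfl hz2 (by rw [hz0]; linarith)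
      (fun s _ hs => by
        have := abs_le.1 (hHB ((z s).1 + δ * dither s))
        exact mul_neg_of_pos_of_neg hγ (clamp_neg_of_neg (by linarith) (by linarith))) ht
    have hlow := ge_of_deriv_pos (c := c - (B + 1)) le_rfl hz2 (by rw [hz0]; linarith)
      (fun s _ hs => by
        have := abs_le.1 (hHB ((z s).1 + δ * dither s))
        exact mul_pos hγ (clamp_pos_of_pos hM0 (by linarith))) ht
    rw [abs_le]
    constructor <;> linarith
  refine ⟨fun t => (z t).1, fun t => (z t).2, fun t ht => ?_, by simp [hz0], by simp [hz0], hyb⟩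
  have hq : q t (z t) = output H δ (z t).1 t - (z t).2 := by
    refine clamp_of_mem ?_
    have h1 := abs_le.1 (hHB ((z t).1 + δ * dither t))
    have h2 := abs_le.1 (hyb t ht)
    constructor <;> linarith
  have h1 := hz1 t ht
  have h2 := hz2 t ht
  simp only [f, hq] at h1 h2
  exact ⟨h1, h2⟩

lemma exists_lipschitz_of_contDiff {h : ℝ → ℝ} (hh : ContDiff ℝ ∞ h) (a b : ℝ) :
    ∃ K : ℝ, 0 ≤ K ∧ ∀ x ∈ Icc a b, ∀ y ∈ Icc a b, |h x - h y| ≤ K * |x - y| := by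
  obtain ⟨K, hK⟩ := (hh.contDiffOn (s := Icc a b)).exists_lipschitzOnWith (by simp)
    (convex_Icc a b) isCompact_Icc
  exact ⟨K, K.2, fun x hx y hy => hK.dist_le_mul x hx y hy⟩

/-- Trajectories of the scheme are determined by their initial state. -/
lemma IsHPFTrajectory.unique {h : ℝ → ℝ} (hh : ContDiff ℝ ∞ h) {δ γ : ℝ} (hδ : 0 ≤ δ)
    (hγ : 0 < γ) {x y x' y' : ℝ → ℝ} (hxy : IsHPFTrajectory h δ γ x y)
    (hxy' : IsHPFTrajectory h δ γ x' y') (hx : x 0 = x' 0) (hy : y 0 = y' 0) {t : ℝ}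
    (ht : 0 ≤ t) : x t = x' t ∧ y t = y' t := by
  obtain ⟨R, hR⟩ := (isCompact_Icc (a := 0) (b := t)).exists_bound_of_continuousOn
    (hxy.continuousOn_fst.mono Icc_subset_Ici_self)
  obtain ⟨R', hR'⟩ := (isCompact_Icc (a := 0) (b := t)).exists_bound_of_continuousOn
    (hxy'.continuousOn_fst.mono Icc_subset_Ici_self)
  set Q := max R R' with hQ
  obtain ⟨K, hK0, hK⟩ := exists_lipschitz_of_contDiff hh (-(Q + δ)) (Q + δ)
  let f : ℝ → ℝ × ℝ → ℝ × ℝ := fun t p =>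
    (-γ * (output h δ p.1 t - p.2) * dither t, γ * (output h δ p.1 t - p.2))
  have hf : ∀ s ∈ Ico 0 t, LipschitzOnWith (Real.toNNReal (γ * (K + 1))) (f s)
      {p : ℝ × ℝ | |p.1| ≤ Q} := by
    intro s _
    refine LipschitzOnWith.of_dist_le_mul fun p hp p' hp' => ?_
    rw [Real.coe_toNNReal _ (by positivity)]
    have h1 : |p.1 - p'.1| ≤ dist p p' := le_max_left _ _
    have h2 : |p.2 - p'.2| ≤ dist p p' := le_max_right _ _
    have hd := abs_le.1 (abs_mul_dither_le hδ s)
    have hp1 := abs_le.1 (show |p.1| ≤ Q from hp)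
    have hp2 := abs_le.1 (show |p'.1| ≤ Q from hp')
    have h3 := hK (p.1 + δ * dither s) ⟨by linarith, by linarith⟩ (p'.1 + δ * dither s)
      ⟨by linarith, by linarith⟩
    rw [add_sub_add_right_eq_sub] at h3
    have hq : γ * |(output h δ p.1 s - p.2) - (output h δ p'.1 s - p'.2)| ≤
        γ * ((K + 1) * dist p p') := by
      refine mul_le_mul_of_nonneg_left ?_ hγ.le
      calc |(output h δ p.1 s - p.2) - (output h δ p'.1 s - p'.2)|
          = |(h (p.1 + δ * dither s) - h (p'.1 + δ * dither s)) - (p.2 - p'.2)| := by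
            simp only [output]; ring_nf
        _ ≤ |h (p.1 + δ * dither s) - h (p'.1 + δ * dither s)| + |p.2 - p'.2| := abs_sub _ _
        _ ≤ K * dist p p' + dist p p' :=
            add_le_add (h3.trans (mul_le_mul_of_nonneg_left h1 hK0)) h2
        _ = _ := by ring
    refine max_le ?_ ?_
    · simp only [f, Real.dist_eq]
      rw [← sub_mul, ← mul_sub, abs_mul, abs_mul, abs_neg, abs_of_pos hγ, mul_assoc γ (K + 1)]
      exact (mul_le_of_le_one_right (by positivity) (abs_dither_le s)).trans hq
    · simp only [f, Real.dist_eq]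
      rw [← mul_sub, abs_mul, abs_of_pos hγ, mul_assoc]
      exact hq
  have heq := ODE_solution_unique_of_mem_Icc_right (v := f) (a := 0) (b := t)
    (f := fun s => (x s, y s)) (g := fun s => (x' s, y' s)) hf
    ((hxy.continuousOn_fst.prodMk hxy.continuousOn_snd).mono Icc_subset_Ici_self)
    (fun s hs => hasDerivWithinAt_Ici_self hs.1 ((hxy s hs.1).1.prodMk (hxy s hs.1).2))
    (fun s hs => (hR s (Ico_subset_Icc_self hs)).trans (le_max_left _ _))
    ((hxy'.continuousOn_fst.prodMk hxy'.continuousOn_snd).mono Icc_subset_Ici_self)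
    (fun s hs => hasDerivWithinAt_Ici_self hs.1 ((hxy' s hs.1).1.prodMk (hxy' s hs.1).2))
    (fun s hs => (hR' s (Ico_subset_Icc_self hs)).trans (le_max_right _ _))
    (by simp [hx, hy]) (⟨ht, le_rfl⟩ : t ∈ Icc 0 t)
  simpa using heq

/-! ### Practical stability of the scheme -/

section Practical

variable {h : ℝ → ℝ} {xs c r δ d L T₁ T γ : ℝ} {S : Set ℝ} {τ : ℝ → ℝ} {β βg : ℝ → ℝ → ℝ}

/-- The trajectory of the scheme is constructed for the cost truncated outside `[xs - r, xs + r]`.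
It is compared with average trajectories issued from its own points: over time `T₁ / γ` these
contract to within `d / 4` of `S ⊆ [xs - δ, xs + δ]`, and they never leave an interval around `xs`
of radius at least `δ`, which confines the trajectory for all time. Comparison over time `T / γ`,
from an arbitrary starting time, then gives the distance to the graph. -/
lemma exists_trajectory_near_graph (hh : ContDiff ℝ ∞ h) (hδ : 0 < δ) (hd : 0 < d)
    (hrd : 0 < r - d - 2 * δ) (hL : 0 < L) (hp : PointsInward h xs δ c)
    (hl : ∀ x₁ ∈ Icc (xs - r) (xs + r), ∀ x₂ ∈ Icc (xs - r) (xs + r),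
      |h x₁ - h x₂| ≤ L * |x₁ - x₂|)
    (hS : IsAvgAttractor h xs δ S τ β βg) (hβ : IsClassKL β) (hβg : IsClassKL βg)
    (hT₁ : 0 < T₁) (hβT : β (2 * r) T₁ ≤ d / 4) (hT : 0 < T)
    (hβgT : βg (2 * r + (2 * (L * r) + 1)) T ≤ d / 2) (hγ : 0 < γ)
    (hγ₁ : 3 * (2 * (L * r) + 1) * Real.exp ((L + 1) * T₁) * γ ≤ d / 4)
    (hγ₂ : 3 * (2 * (L * r) + 1) * Real.exp ((L + 1) * T) * γ ≤ d / 4) {x₀ y₀ : ℝ}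
    (hx₀ : |x₀ - xs| ≤ r - d - δ) (hy₀ : |y₀ - h xs| ≤ L * r + 1) :
    ∃ x y : ℝ → ℝ, IsHPFTrajectory h δ γ x y ∧ x 0 = x₀ ∧ y 0 = y₀ ∧
      (∀ t, 0 ≤ t → |x t - xs| ≤ r ∧ |y t - h xs| ≤ L * r + 1) ∧
      ∀ t, T / γ ≤ t → Metric.infDist !₂[x t, y t] (graphOver τ S) ≤ d := by
  have hr : 0 < r := by linarith
  have hLr : 0 < L * r := mul_pos hL hr
  have hxsm : xs ∈ Icc (xs - r) (xs + r) := ⟨by linarith, by linarith⟩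
  set H : ℝ → ℝ := fun x => h (clamp (xs - r) (xs + r) x) with hHdef
  have hclamp : ∀ x, clamp (xs - r) (xs + r) x ∈ Icc (xs - r) (xs + r) :=
    clamp_mem (by linarith)
  have hH : ∀ u v, |H u - H v| ≤ L * |u - v| := fun u v =>
    (hl _ (hclamp u) _ (hclamp v)).trans (mul_le_mul_of_nonneg_left (abs_clamp_sub_le _ _ _ _) hL.le)
  have hlxs : ∀ x ∈ Icc (xs - r) (xs + r), |h x - h xs| ≤ L * r := fun x hx =>
    (hl x hx xs hxsm).trans (mul_le_mul_of_nonneg_left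
      (abs_le.2 ⟨by linarith [hx.1], by linarith [hx.2]⟩) hL.le)
  have hHB : ∀ u, |H u - h xs| ≤ L * r := fun u => hlxs _ (hclamp u)
  have hHh : ∀ z, |z - xs| ≤ r - δ → ∀ t, H (z + δ * dither t) = h (z + δ * dither t) := by
    intro z hz t
    have h1 := abs_le.1 hz
    have h2 := abs_le.1 (abs_mul_dither_le hδ.le t)
    simp only [hHdef]
    rw [clamp_of_mem ⟨by linarith, by linarith⟩]
  obtain ⟨x, y, hxy, hx0, hy0, hyb⟩ := exists_IsHPFTrajectory (δ := δ) (x₀ := x₀) hγ hL.le hLr.le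
    hH hHB hy₀
  have hM : ∀ t, 0 ≤ t → |output H δ (x t) t - y t| ≤ 2 * (L * r) + 1 := by
    intro t ht
    have h1 := abs_le.1 (hHB (x t + δ * dither t))
    have h2 := abs_le.1 (hyb t ht)
    exact abs_le.2 ⟨by simp only [output]; linarith, by simp only [output]; linarith⟩
  -- Average trajectories issued from a point of the trajectory.
  have near : ∀ t₁, 0 ≤ t₁ → |x t₁ - xs| ≤ r - δ → ∃ xa ya : ℝ → ℝ,
      IsHPFAvgTrajectory h δ γ xa ya ∧ xa 0 = x t₁ ∧ ya 0 = y t₁ ∧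
      ∀ T', ∀ t, 0 ≤ t → γ * t ≤ T' →
        |x (t₁ + t) - xa t| ≤ 3 * (2 * (L * r) + 1) * Real.exp ((L + 1) * T') * γ ∧
        |y (t₁ + t) - ya t| ≤ 3 * (2 * (L * r) + 1) * Real.exp ((L + 1) * T') * γ := by
    intro t₁ ht₁ hxt₁
    obtain ⟨xa, ya, ha, hxa, hya⟩ := (hS.graph_gas γ hγ).1 (x t₁) (y t₁)
    refine ⟨xa, ya, ha, hxa, hya, fun T' t ht htT => ?_⟩
    have hin : ∀ s, 0 ≤ s → |xa s - xs| ≤ r - δ := fun s hs =>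
      ha.1.abs_sub_le hp hγ (by linarith) (by rwa [hxa]) hs
    have haH : IsHPFAvgTrajectory H δ γ xa ya := by
      refine ⟨fun s hs => ?_, fun s hs => ?_⟩
      · rw [(coeff_congr (hHh _ (hin s hs))).1]
        exact ha.1 s hs
      · rw [(coeff_congr (hHh _ (hin s hs))).2]
        exact ha.2 s hs
    exact hxy.abs_sub_average_le hδ.le hγ hL.le (by linarith) hH hM haH ht₁ hxa hya ht htT
  obtain ⟨xe, hxe, hxe0⟩ := hp.exists_equilibrium hh.continuous hδ.le
  obtain ⟨hxeS, hpe⟩ := hS.equilibrium_mem hβg hxe0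
  have hβγ : ∀ t : ℝ, γ * (t / γ) = t := fun t => by field_simp
  have hstep : ∀ k : ℕ, |x (k * (T₁ / γ)) - xs| ≤ r - δ - d / 2 := by
    have hTγ : 0 < T₁ / γ := div_pos hT₁ hγ
    intro k
    induction k with
    | zero => simpa [hx0] using hx₀.trans (by linarith)
    | succ k ih =>
      have hk : 0 ≤ (k : ℝ) * (T₁ / γ) := by positivity
      obtain ⟨xa, ya, ha, hxa, hya, hclose⟩ := near _ hk (ih.trans (by linarith))
      have h1 := abs_le.1 ((hclose T₁ (T₁ / γ) hTγ.le (hβγ T₁).le).1.trans hγ₁)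
      have hdist0 : Metric.infDist (xa 0) S ≤ 2 * r := by
        refine (Metric.infDist_le_dist_of_mem hxeS).trans ?_
        rw [hxa, Real.dist_eq]
        have := abs_le.1 ih
        exact abs_le.2 ⟨by linarith [hxe.2], by linarith [hxe.1]⟩
      have hdist := (hS.gas γ hγ).2 xa ha.1 (T₁ / γ) hTγ.le
      rw [hβγ] at hdist
      have hmono := (hβ.classK T₁ hT₁.le).strictMonoOn.monotoneOn
        (mem_Ici.2 (Metric.infDist_nonneg (x := xa 0) (s := S))) (mem_Ici.2 (by linarith)) hdist0
      obtain ⟨z, hz, hzd⟩ := hS.isCompact.exists_infDist_eq_dist hS.nonempty (xa (T₁ / γ))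
      have hz' : |xa (T₁ / γ) - z| ≤ d / 4 := by
        rw [← Real.dist_eq, ← hzd]
        exact hdist.trans (hmono.trans hβT)
      have h2 := abs_le.1 hz'
      have h3 := hS.subset hz
      rw [show ((k + 1 : ℕ) : ℝ) * (T₁ / γ) = k * (T₁ / γ) + T₁ / γ by push_cast; ring]
      exact abs_le.2 ⟨by linarith [h3.1], by linarith [h3.2]⟩
  have hxr : ∀ t, 0 ≤ t → |x t - xs| ≤ r - δ - d / 4 := by
    have hTγ : 0 < T₁ / γ := div_pos hT₁ hγ
    intro t ht
    set k := ⌊t / (T₁ / γ)⌋₊ with hkdef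
    have hk : 0 ≤ (k : ℝ) * (T₁ / γ) := by positivity
    have hk1 : (k : ℝ) * (T₁ / γ) ≤ t :=
      (le_div_iff₀ hTγ).1 (Nat.floor_le (div_nonneg ht hTγ.le))
    have hk2 : t < (k + 1) * (T₁ / γ) := (div_lt_iff₀ hTγ).1 (Nat.lt_floor_add_one _)
    obtain ⟨xa, ya, ha, hxa, hya, hclose⟩ := near _ hk ((hstep k).trans (by linarith))
    have hs0 : 0 ≤ t - k * (T₁ / γ) := sub_nonneg.2 hk1
    have hs1 : γ * (t - k * (T₁ / γ)) ≤ T₁ := by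
      rw [← hβγ T₁]
      exact mul_le_mul_of_nonneg_left (by rw [hβγ]; linarith) hγ.le
    have h1 := abs_le.1 ((hclose T₁ _ hs0 hs1).1.trans hγ₁)
    rw [add_sub_cancel] at h1
    have h2 := abs_le.1 (ha.1.abs_sub_le hp hγ (ρ := r - δ - d / 2) (by linarith)
      (by rw [hxa]; exact hstep k) hs0)
    exact abs_le.2 ⟨by linarith, by linarith⟩
  refine ⟨x, y, fun t ht => ?_, hx0, hy0, fun t ht =>
    ⟨(hxr t ht).trans (by linarith), hyb t ht⟩, fun t ht => ?_⟩
  · have h1 := hxy t ht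
    have h2 : output H δ (x t) t = output h δ (x t) t := hHh _ ((hxr t ht).trans (by linarith)) t
    rwa [h2] at h1
  · have hTγ : 0 < T / γ := div_pos hT hγ
    have ht₁ : 0 ≤ t - T / γ := sub_nonneg.2 ht
    have hxt := (hxr _ ht₁).trans (show r - δ - d / 4 ≤ r - δ by linarith)
    obtain ⟨xa, ya, ha, hxa, hya, hclose⟩ := near _ ht₁ hxt
    have h1 := hclose T (T / γ) hTγ.le (hβγ T).le
    rw [sub_add_cancel] at h1
    have hdist := (hS.graph_gas γ hγ).2 xa ya ha (T / γ) hTγ.le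
    rw [hβγ] at hdist
    have hdist0 : Metric.infDist !₂[xa 0, ya 0] (graphOver τ S) ≤ 2 * r + (2 * (L * r) + 1) := by
      refine (Metric.infDist_le_dist_of_mem hpe).trans ((dist_pair_le _ _ _ _).trans ?_)
      rw [hxa, hya]
      have h2 := abs_le.1 hxt
      have h3 : |cosCoeff h δ 0 xe / 2 - h xs| ≤ L * r :=
        abs_cosCoeff_sub_const_le hh.continuous fun s => by
          have h4 := abs_le.1 (abs_mul_dither_le hδ.le s)
          exact hlxs _ ⟨by linarith [hxe.1], by linarith [hxe.2]⟩
      have h4 := abs_le.1 h3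
      have h5 := abs_le.1 (hyb _ ht₁)
      refine add_le_add (abs_le.2 ⟨by linarith [hxe.2], by linarith [hxe.1]⟩)
        (abs_le.2 ⟨by linarith, by linarith⟩)
    have hmono := (hβg.classK T hT.le).strictMonoOn.monotoneOn
      (mem_Ici.2 (Metric.infDist_nonneg (x := !₂[xa 0, ya 0]) (s := graphOver τ S)))
      (mem_Ici.2 (by positivity)) hdist0
    have h6 := Metric.infDist_le_infDist_add_dist (s := graphOver τ S) (x := !₂[x t, y t])
      (y := !₂[xa (T / γ), ya (T / γ)])
    have h7 := dist_pair_le (x t) (y t) (xa (T / γ)) (ya (T / γ))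
    linarith [h1.1, h1.2]

end Practical

/-- **Practical stability, uniformly in the cost.** The times `T₁` and `T` after which `β` and `βg`
have decayed to a fraction of `d` are determined by the estimates, `r` and `L`; the bound on the
gain makes the averaging error over these times a fraction of `d`. -/
theorem practical_stability {r δ d : ℝ} (hδ : 0 < δ) (hd : 0 < d)
    (hrd : 0 < r - d - 2 * δ) {L : ℝ} {β βg : ℝ → ℝ → ℝ} (hL : 0 < L)
    (hβ : IsClassKL β) (hβ0 : IsClassKInfty (fun s => β s 0)) (hβg : IsClassKL βg) :
    ∃ tbar γs : ℝ, 0 < tbar ∧ 0 < γs ∧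
      ∀ (h : ℝ → ℝ) (xs c : ℝ) (S : Set ℝ) (τ : ℝ → ℝ),
        ContDiff ℝ ∞ h → PointsInward h xs δ c →
        (∀ x₁ ∈ Set.Icc (xs - r) (xs + r), ∀ x₂ ∈ Set.Icc (xs - r) (xs + r),
          |h x₁ - h x₂| ≤ L * |x₁ - x₂|) →
        IsAvgAttractor h xs δ S τ β βg →
        ∀ γ : ℝ, 0 < γ → γ < γs → ∀ x₀ y₀ : ℝ,
          |x₀ - xs| ≤ chi β (r - d - 2 * δ) → |y₀ - cosCoeff h δ 0 x₀ / 2| ≤ γs →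
          (∃ x y : ℝ → ℝ, IsHPFTrajectory h δ γ x y ∧ x 0 = x₀ ∧ y 0 = y₀) ∧
          ∀ x y : ℝ → ℝ, IsHPFTrajectory h δ γ x y → x 0 = x₀ → y 0 = y₀ →
            (∃ C : ℝ, ∀ t, 0 ≤ t → |x t| ≤ C ∧ |y t| ≤ C) ∧
            ∀ t, tbar / γ ≤ t → Metric.infDist !₂[x t, y t] (graphOver τ S) ≤ d := by
  have hr : 0 < r := by linarith
  have hLr : 0 < L * r := mul_pos hL hr
  obtain ⟨T₁, hβT, hT₁⟩ := (((hβ.tendsto_zero (2 * r) (by positivity)).eventually_le_const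
    (show 0 < d / 4 by positivity)).and (eventually_gt_atTop 0)).exists
  obtain ⟨T, hβgT, hT⟩ := (((hβg.tendsto_zero (2 * r + (2 * (L * r) + 1))
    (by positivity)).eventually_le_const (show 0 < d / 2 by positivity)).and
    (eventually_gt_atTop 0)).exists
  set C : ℝ → ℝ := fun T => 3 * (2 * (L * r) + 1) * Real.exp ((L + 1) * T) with hC
  have hC0 : ∀ T, 0 < C T := fun T => by positivity
  refine ⟨T, min 1 (min (d / 4 / C T₁) (d / 4 / C T)), hT,
    lt_min one_pos (lt_min (div_pos (by positivity) (hC0 _)) (div_pos (by positivity) (hC0 _))),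
    fun h xs c S τ hh hp hl hS γ hγ hγs x₀ y₀ hx₀ hy₀ => ?_⟩
  have hγ₁ : C T₁ * γ ≤ d / 4 := by
    rw [mul_comm, ← le_div_iff₀ (hC0 _)]
    exact hγs.le.trans ((min_le_right _ _).trans (min_le_left _ _))
  have hγ₂ : C T * γ ≤ d / 4 := by
    rw [mul_comm, ← le_div_iff₀ (hC0 _)]
    exact hγs.le.trans ((min_le_right _ _).trans (min_le_right _ _))
  have hx₀' : |x₀ - xs| ≤ r - d - δ :=
    (hx₀.trans (chi_le hβ0 (fun s hs => hS.le_estimate hs) hrd.le)).trans (by linarith)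
  have hy₀' : |y₀ - h xs| ≤ L * r + 1 := by
    have h1 : |cosCoeff h δ 0 x₀ / 2 - h xs| ≤ L * r :=
      abs_cosCoeff_sub_const_le hh.continuous fun s => by
        have h4 := abs_le.1 (abs_mul_dither_le hδ.le s)
        have h5 := abs_le.1 hx₀'
        refine (hl _ ⟨by linarith, by linarith⟩ xs ⟨by linarith, by linarith⟩).trans
          (mul_le_mul_of_nonneg_left (abs_le.2 ⟨by linarith, by linarith⟩) hL.le)
    have h2 := hy₀.trans (min_le_left _ _)
    have h3 := abs_sub_le y₀ (cosCoeff h δ 0 x₀ / 2) (h xs)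
    linarith
  obtain ⟨x, y, hxy, hx, hy, hbd, hlim⟩ := exists_trajectory_near_graph hh hδ hd hrd hL hp hl hS hβ
    hβg hT₁ hβT hT hβgT hγ hγ₁ hγ₂ hx₀' hy₀'
  refine ⟨⟨x, y, hxy, hx, hy⟩, fun x' y' hxy' hx' hy' => ?_⟩
  have heq : ∀ t, 0 ≤ t → x' t = x t ∧ y' t = y t := fun t ht =>
    hxy'.unique hh hδ.le hγ hxy (hx'.trans hx.symm) (hy'.trans hy.symm) ht
  refine ⟨⟨|xs| + r + (|h xs| + (L * r + 1)), fun t ht => ?_⟩, fun t ht => ?_⟩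
  · rw [(heq t ht).1, (heq t ht).2]
    have h1 := hbd t ht
    have h2 := abs_sub_abs_le_abs_sub (x t) xs
    have h3 := abs_sub_abs_le_abs_sub (y t) (h xs)
    constructor
    · linarith [abs_nonneg (h xs), h1.1]
    · linarith [abs_nonneg xs, h1.2]
  · have ht0 : 0 ≤ t := (div_pos hT hγ).le.trans ht
    rw [(heq t ht0).1, (heq t ht0).2]
    exact hlim t ht

/-! ### The invariant graph -/

/-- For a skew product `x' = -G x`, `y' = -y + A x` with `G` bounded and Lipschitz and `A` bounded,
the response to the full backward orbit, `τ x = ∫₀^∞ e⁻ˢ A (Ψₛ x) ds` with `Ψ` the flow of `G`, is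
continuous, and its graph is invariant: along solutions, `τ` satisfies the variation of constants
formula for the second equation. -/
lemma exists_invariant_graph {G A : ℝ → ℝ} {K C : ℝ≥0} {B : ℝ} (hG : LipschitzWith K G)
    (hC : ∀ x, ‖G x‖ ≤ C) (hA : Continuous A) (hB : ∀ x, |A x| ≤ B) :
    ∃ τ : ℝ → ℝ, Continuous τ ∧ ∀ x : ℝ → ℝ,
      (∀ t, 0 ≤ t → HasDerivWithinAt x (-G (x t)) (Ici 0) t) → ∀ t, 0 ≤ t →
        τ (x t) = Real.exp (-t) * (τ (x 0) + ∫ s in (0 : ℝ)..t, Real.exp s * A (x s)) := by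
  choose Ψ hΨ0 hΨ using exists_solution_of_bounded_lipschitz (f := fun _ : ℝ => G)
    (fun _ => hG) (fun _ => continuous_const) (fun _ => hC)
  have hΨc : ∀ x, ContinuousOn (Ψ x) (Ici 0) := fun x => continuousOn_of_hasDerivWithinAt (hΨ x)
  have hFc : ∀ x, ContinuousOn (fun s => Real.exp (-s) * A (Ψ x s)) (Ici 0) := fun x =>
    (by fun_prop : Continuous fun s : ℝ => Real.exp (-s)).continuousOn.mul
      (hA.comp_continuousOn (hΨc x))
  have hmeas : ∀ x, MeasureTheory.AEStronglyMeasurable (fun s => Real.exp (-s) * A (Ψ x s))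
      (MeasureTheory.volume.restrict (Ioi 0)) := fun x =>
    ((hFc x).mono Ioi_subset_Ici_self).aestronglyMeasurable measurableSet_Ioi
  have hle : ∀ x s, ‖Real.exp (-s) * A (Ψ x s)‖ ≤ Real.exp (-s) * B := fun x s => by
    rw [Real.norm_eq_abs, abs_mul, abs_of_pos (Real.exp_pos _)]
    exact mul_le_mul_of_nonneg_left (hB _) (Real.exp_pos _).le
  have hbi : MeasureTheory.IntegrableOn (fun s => Real.exp (-s) * B) (Ioi 0) :=
    (integrableOn_exp_neg_Ioi 0).mul_const B
  have hint : ∀ x, MeasureTheory.IntegrableOn (fun s => Real.exp (-s) * A (Ψ x s)) (Ioi 0) :=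
    fun x => MeasureTheory.Integrable.mono' hbi (hmeas x) (Eventually.of_forall (hle x))
  refine ⟨fun x => ∫ s in Ioi 0, Real.exp (-s) * A (Ψ x s), ?_, ?_⟩
  · refine MeasureTheory.continuous_of_dominated hmeas
      (fun x => Eventually.of_forall (hle x)) hbi ?_
    filter_upwards [MeasureTheory.ae_restrict_mem measurableSet_Ioi] with s hs
    have hlip : LipschitzWith (Real.toNNReal (Real.exp (K * s))) fun x => Ψ x s := by
      refine LipschitzWith.of_dist_le_mul fun x x' => ?_
      have := dist_le_of_trajectories_ODE (v := fun _ => G) (a := 0) (b := s) (fun _ => hG)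
        ((hΨc x).mono Icc_subset_Ici_self)
        (fun t ht => hasDerivWithinAt_Ici_self ht.1 (hΨ x t ht.1))
        ((hΨc x').mono Icc_subset_Ici_self)
        (fun t ht => hasDerivWithinAt_Ici_self ht.1 (hΨ x' t ht.1)) le_rfl s ⟨le_of_lt hs, le_rfl⟩
      rw [hΨ0, hΨ0, sub_zero] at this
      rwa [Real.coe_toNNReal _ (Real.exp_pos _).le, mul_comm]
    exact continuous_const.mul (hA.comp hlip.continuous)
  · intro x hx t ht
    have hxc := continuousOn_of_hasDerivWithinAt hx
    -- The backward flow from `x t` retraces the solution, then follows the backward flow of `x 0`.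
    have hback : EqOn (Ψ (x t)) (fun s => x (t - s)) (Icc 0 t) := by
      refine ODE_solution_unique_of_mem_Icc_right (v := fun _ => G) (s := fun _ => univ) (K := K)
        (fun _ _ => hG.lipschitzOnWith) ((hΨc _).mono Icc_subset_Ici_self)
        (fun s hs => hasDerivWithinAt_Ici_self hs.1 (hΨ _ s hs.1)) (fun _ _ => mem_univ _)
        (hxc.comp (by fun_prop) fun s hs => sub_nonneg.2 hs.2) (fun s hs => ?_)
        (fun _ _ => mem_univ _) (by simp [hΨ0])
      have hpos : 0 < t - s := sub_pos.2 hs.2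
      have := ((hx _ hpos.le).hasDerivAt (Ici_mem_nhds hpos)).comp_const_sub t s
      rw [neg_neg] at this
      exact this.hasDerivWithinAt
    have hfar : ∀ s, 0 ≤ s → Ψ (x t) (t + s) = Ψ (x 0) s := fun s hs =>
      solution_unique_of_lipschitz (f := fun _ => G) (fun _ => hG)
        (α := fun s => Ψ (x t) (t + s))
        (fun s hs => hasDerivWithinAt_comp_const_add ht (hΨ _ (t + s) (add_nonneg ht hs)))
        (hΨ (x 0)) (by
          have h1 : Ψ (x t) t = x (t - t) := hback ⟨ht, le_rfl⟩
          rw [hΨ0, add_zero, h1, sub_self]) hs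
    have hsplit := intervalIntegral.integral_interval_add_Ioi (hint (x t))
      ((hint (x t)).mono_set (Ioi_subset_Ioi ht))
    have hnear : ∫ s in (0 : ℝ)..t, Real.exp (-s) * A (Ψ (x t) s) =
        Real.exp (-t) * ∫ s in (0 : ℝ)..t, Real.exp s * A (x s) := by
      have h1 : ∫ s in (0 : ℝ)..t, Real.exp (-s) * A (Ψ (x t) s) =
          ∫ s in (0 : ℝ)..t, Real.exp (-t) * (Real.exp (t - s) * A (x (t - s))) := by
        refine intervalIntegral.integral_congr fun s hs => ?_
        rw [uIcc_of_le ht] at hs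
        have h2 : Ψ (x t) s = x (t - s) := hback hs
        simp only [h2]
        rw [← mul_assoc, ← Real.exp_add]
        congr 2
        ring
      rw [h1, intervalIntegral.integral_const_mul, intervalIntegral.integral_comp_sub_left
        (fun s => Real.exp s * A (x s)) t]
      simp
    have htail : ∫ s in Ioi t, Real.exp (-s) * A (Ψ (x t) s) =
        Real.exp (-t) * ∫ s in Ioi 0, Real.exp (-s) * A (Ψ (x 0) s) := by
      have h1 := (MeasureTheory.measurePreserving_add_left MeasureTheory.volume
        t).setIntegral_preimage_emb (measurableEmbedding_addLeft t)
        (fun s => Real.exp (-s) * A (Ψ (x t) s)) (Ioi t)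
      rw [preimage_const_add_Ioi, sub_self] at h1
      rw [← h1, ← MeasureTheory.integral_const_mul]
      refine MeasureTheory.setIntegral_congr_fun measurableSet_Ioi fun s hs => ?_
      simp only [hfar s (le_of_lt hs)]
      rw [← mul_assoc, ← Real.exp_add]
      congr 2
      ring
    simp only
    rw [← hsplit, hnear, htail]
    ring

/-- Variation of constants for `y' = -y + A`. -/
lemma eq_of_linear_filter {y A : ℝ → ℝ} (hA : ContinuousOn A (Ici 0))
    (hy : ∀ t, 0 ≤ t → HasDerivWithinAt y (-y t + A t) (Ici 0) t) {t : ℝ} (ht : 0 ≤ t) :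
    y t = Real.exp (-t) * (y 0 + ∫ s in (0 : ℝ)..t, Real.exp s * A s) := by
  have hd : ∀ t, 0 ≤ t →
      HasDerivWithinAt (fun t => Real.exp t * y t) (Real.exp t * A t) (Ici 0) t := fun t ht =>
    ((Real.hasDerivAt_exp t).hasDerivWithinAt.mul (hy t ht)).congr_deriv (by ring)
  have hc : ContinuousOn (fun t => Real.exp t * A t) (Ici 0) :=
    Real.continuous_exp.continuousOn.mul hA
  have h1 := intervalIntegral.integral_eq_sub_of_hasDeriv_right_of_le ht
    ((continuousOn_of_hasDerivWithinAt hd).mono Icc_subset_Ici_self)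
    (fun s hs => (hd s hs.1.le).mono fun u hu => hs.1.le.trans (le_of_lt hu))
    ((hc.mono Icc_subset_Ici_self).intervalIntegrable_of_Icc ht)
  rw [h1, Real.exp_zero, one_mul, add_sub_cancel, ← mul_assoc, ← Real.exp_add, neg_add_cancel,
    Real.exp_zero, one_mul]

lemma exists_linear_filter {A : ℝ → ℝ} (hA : ContinuousOn A (Ici 0)) (y₀ : ℝ) :
    ∃ y : ℝ → ℝ, y 0 = y₀ ∧ ∀ t, 0 ≤ t → HasDerivWithinAt y (-y t + A t) (Ici 0) t := by
  have hc : Continuous fun s => Real.exp s * A (max s 0) :=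
    Real.continuous_exp.mul (hA.comp_continuous (by fun_prop) fun s => le_max_right s 0)
  refine ⟨fun t => Real.exp (-t) * (y₀ + ∫ s in (0 : ℝ)..t, Real.exp s * A (max s 0)), by simp,
    fun t ht => ?_⟩
  have h1 : HasDerivAt (fun t => ∫ s in (0 : ℝ)..t, Real.exp s * A (max s 0))
      (Real.exp t * A (max t 0)) t := (hc.integral_hasStrictDerivAt 0 t).hasDerivAt
  have h2 : HasDerivAt (fun t : ℝ => Real.exp (-t)) (-Real.exp (-t)) t := by
    simpa using (hasDerivAt_neg t).exp
  refine (h2.mul (h1.const_add y₀)).hasDerivWithinAt.congr_deriv ?_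
  have h3 : Real.exp (-t) * Real.exp t = 1 := by rw [← Real.exp_add]; simp
  rw [max_eq_left ht]
  linear_combination A t * h3

/-! ### Comparison functions -/

/-- A quantity that is bounded where `D` is bounded, and small where `D` is small, is dominated by
a class `K` function of `D`. -/
lemma exists_classK_majorant {ι : Type*} {V D : ι → ℝ} (hD : ∀ i, 0 ≤ D i)
    (hbdd : ∀ R, ∃ K, ∀ i, D i ≤ R → V i ≤ K)
    (hsmall : ∀ ε, 0 < ε → ∃ η, 0 < η ∧ ∀ i, D i ≤ η → V i ≤ ε) :
    ∃ W : ℝ → ℝ, IsClassK W ∧ ∀ i, V i ≤ W (D i) := by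
  let s : ℝ → Set ℝ := fun R => insert 0 (V '' {i | D i ≤ R})
  let w : ℝ → ℝ := fun R => sSup (s R)
  have hs : ∀ R, BddAbove (s R) := by
    intro R
    obtain ⟨K, hK⟩ := hbdd R
    refine BddAbove.insert 0 ⟨K, ?_⟩
    rintro _ ⟨i, hi, rfl⟩
    exact hK i hi
  have hmono : Monotone w := fun R R' h => csSup_le_csSup (hs R') ⟨0, mem_insert _ _⟩
    (insert_subset_insert (image_mono fun i hi => le_trans hi h))
  have hw0 : ∀ R, 0 ≤ w R := fun R => le_csSup (hs R) (mem_insert _ _)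
  have hwε : ∀ ε, 0 < ε → ∃ η, 0 < η ∧ w η ≤ ε := by
    intro ε hε
    obtain ⟨η, hη, h⟩ := hsmall ε hε
    refine ⟨η, hη, csSup_le ⟨0, mem_insert _ _⟩ ?_⟩
    rintro _ (rfl | ⟨i, hi, rfl⟩)
    · exact hε.le
    · exact h i hi
  have hwz : w 0 = 0 := by
    refine le_antisymm (le_of_forall_pos_le_add fun ε hε => ?_) (hw0 0)
    obtain ⟨η, hη, h⟩ := hwε ε hε
    rw [zero_add]
    exact (hmono hη.le).trans h
  have hint : ∀ a b, IntervalIntegrable w MeasureTheory.volume a b := fun a b =>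
    hmono.intervalIntegrable
  have hcomp : ∀ R, 0 ≤ R → IntervalIntegrable (fun σ => w (R * σ)) MeasureTheory.volume 1 2 :=
    fun R hR => (hmono.comp (monotone_mul_left_of_nonneg hR)).intervalIntegrable
  -- Averaging the monotone function `w` over `[R, 2R]` makes it continuous.
  let W : ℝ → ℝ := fun R => R + ∫ σ in (1 : ℝ)..2, w (R * σ)
  have hIle : ∀ R, 0 ≤ R → ∫ σ in (1 : ℝ)..2, w (R * σ) ≤ w (2 * R) := by
    intro R hR
    have := intervalIntegral.integral_mono_on (by norm_num : (1 : ℝ) ≤ 2) (hcomp R hR)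
      (intervalIntegrable_const (c := w (2 * R))) fun σ hσ => hmono (by nlinarith [hσ.2])
    rw [intervalIntegral.integral_const] at this
    norm_num at this
    exact this
  have hIge : ∀ R, 0 ≤ R → w R ≤ ∫ σ in (1 : ℝ)..2, w (R * σ) := by
    intro R hR
    have := intervalIntegral.integral_mono_on (by norm_num : (1 : ℝ) ≤ 2)
      (intervalIntegrable_const (c := w R)) (hcomp R hR) fun σ hσ => hmono (by nlinarith [hσ.1])
    rw [intervalIntegral.integral_const] at this
    norm_num at this
    exact this
  refine ⟨W, ⟨fun R hR => ?_, fun R hR R' _ h => ?_, ?_⟩, fun i => ?_⟩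
  · rcases eq_or_lt_of_le (mem_Ici.1 hR) with rfl | hpos
    · have hW0 : W 0 = 0 := by simp [W, hwz]
      rw [ContinuousWithinAt, hW0, Metric.tendsto_nhdsWithin_nhds]
      intro ε hε
      obtain ⟨η, hη, h⟩ := hwε (ε / 2) (half_pos hε)
      refine ⟨min (η / 2) (ε / 2), by positivity, fun R hR hdist => ?_⟩
      have hR0 : 0 ≤ R := hR
      rw [Real.dist_eq, sub_zero, abs_of_nonneg hR0, lt_min_iff] at hdist
      have h1 := hIle R hR0
      have h2 := hmono (show 2 * R ≤ η by linarith)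
      have h3 : 0 ≤ W R := add_nonneg hR0 ((hw0 R).trans (hIge R hR0))
      rw [Real.dist_eq, sub_zero, abs_of_nonneg h3]
      simp only [W]
      linarith
    · have hprim : Continuous fun t => ∫ σ in (0 : ℝ)..t, w σ :=
        intervalIntegral.continuous_primitive hint 0
      have hc : ContinuousAt (fun R : ℝ =>
          R + R⁻¹ * ((∫ σ in (0 : ℝ)..(R * 2), w σ) - ∫ σ in (0 : ℝ)..R, w σ)) R := by
        refine continuousAt_id.add ((continuousAt_inv₀ hpos.ne').mul ?_)
        exact ((hprim.comp (continuous_mul_const 2)).sub hprim).continuousAt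
      refine (hc.congr ?_).continuousWithinAt
      filter_upwards [lt_mem_nhds hpos] with R' hR'
      have h1 := intervalIntegral.mul_integral_comp_mul_left (a := 1) (b := 2) (f := w) (c := R')
      rw [mul_one] at h1
      rw [intervalIntegral.integral_interval_sub_left (hint _ _) (hint _ _), ← h1, ← mul_assoc,
        inv_mul_cancel₀ (ne_of_gt hR'), one_mul]
  · refine add_lt_add_of_lt_of_le h ?_
    have hR0 : 0 ≤ R := hR
    exact intervalIntegral.integral_mono_on (by norm_num) (hcomp R hR0) (hcomp R' (hR0.trans h.le))
      fun σ hσ => hmono (by nlinarith [hσ.1])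
  · simp [W, hwz]
  · have h1 : V i ≤ w (D i) := le_csSup (hs _) (mem_insert_of_mem _ ⟨i, show D i ≤ D i from le_rfl, rfl⟩)
    have h2 := hIge _ (hD i)
    have h3 := hD i
    simp only [W]
    linarith

/-- A class `KL` estimate for motion towards a set at speed `k`. It replaces the distance
`max (s - k * t) 0`, which is not strictly increasing in `s`. -/
noncomputable def entryEstimate (k s t : ℝ) : ℝ := s * Real.exp (-(k * t / (1 + s)))

section EntryEstimate

variable {k : ℝ}

lemma sub_le_entryEstimate (hk : 0 ≤ k) {s t : ℝ} (hs : 0 ≤ s) (ht : 0 ≤ t) :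
    max (s - k * t) 0 ≤ entryEstimate k s t := by
  refine max_le ?_ (by unfold entryEstimate; positivity)
  have h1 := Real.add_one_le_exp (-(k * t / (1 + s)))
  have h2 : s * (k * t / (1 + s)) ≤ k * t := by
    rw [mul_div_assoc', div_le_iff₀ (by positivity)]
    nlinarith [mul_nonneg hk ht]
  unfold entryEstimate
  nlinarith [mul_le_mul_of_nonneg_left h1 hs]

lemma entryEstimate_zero (k : ℝ) : (fun s => entryEstimate k s 0) = id := by
  ext s
  simp [entryEstimate]

lemma isClassKL_entryEstimate (hk : 0 < k) : IsClassKL (entryEstimate k) where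
  classK t ht :=
    { continuousOn := by
        unfold entryEstimate
        refine continuousOn_id.mul (Real.continuous_exp.comp_continuousOn
          (ContinuousOn.neg (continuousOn_const.div (by fun_prop) fun s hs => ?_)))
        have : (0 : ℝ) ≤ s := hs
        positivity
      strictMonoOn := by
        intro s hs s' hs' h
        have hs0 : (0 : ℝ) ≤ s := hs
        have hs0' : (0 : ℝ) ≤ s' := hs'
        have h1 : Real.exp (-(k * t / (1 + s))) ≤ Real.exp (-(k * t / (1 + s'))) := by
          refine Real.exp_le_exp.2 (neg_le_neg ?_)
          gcongr
        exact (mul_le_mul_of_nonneg_left h1 hs0).trans_lt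
          (mul_lt_mul_of_pos_right h (Real.exp_pos _))
      map_zero := by simp [entryEstimate] }
  antitoneOn s hs t ht t' ht' h := by
    unfold entryEstimate
    gcongr
  tendsto_zero s hs := by
    have h1 : Tendsto (fun t => k * t / (1 + s)) atTop atTop :=
      (tendsto_id.const_mul_atTop hk).atTop_div_const (by positivity)
    have := (Real.tendsto_exp_neg_atTop_nhds_zero.comp h1).const_mul s
    rw [mul_zero] at this
    exact this

lemma isClassKInfty_entryEstimate_zero (k : ℝ) : IsClassKInfty fun s => entryEstimate k s 0 := by
  rw [entryEstimate_zero]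
  exact ⟨⟨continuousOn_id, strictMonoOn_id, rfl⟩, tendsto_id⟩

lemma IsClassKL.add_exp_mul {β : ℝ → ℝ → ℝ} {W : ℝ → ℝ} (hβ : IsClassKL β) (hW : IsClassK W) :
    IsClassKL fun s t => β s t + Real.exp (-t) * W s where
  classK t ht :=
    { continuousOn := (hβ.classK t ht).continuousOn.add (continuousOn_const.mul hW.continuousOn)
      strictMonoOn := (hβ.classK t ht).strictMonoOn.add
        fun s hs s' hs' h => mul_lt_mul_of_pos_left (hW.strictMonoOn hs hs' h) (Real.exp_pos _)
      map_zero := by simp [(hβ.classK t ht).map_zero, hW.map_zero] }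
  antitoneOn s hs t ht t' ht' h := by
    have h0 : 0 ≤ W s := by
      rw [← hW.map_zero]
      exact hW.strictMonoOn.monotoneOn (mem_Ici.2 le_rfl) (mem_Ici.2 hs) hs
    exact add_le_add (hβ.antitoneOn s hs ht ht' h) (mul_le_mul_of_nonneg_right
      (Real.exp_le_exp.2 (neg_le_neg h)) h0)
  tendsto_zero s hs := by
    have := (hβ.tendsto_zero s hs).add (Real.tendsto_exp_neg_atTop_nhds_zero.mul_const (W s))
    rw [zero_mul, add_zero] at this
    exact this

end EntryEstimate

/-! ### Existence and time scaling for the average systems -/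

section Existence

variable {h : ℝ → ℝ} {xs δ c γ : ℝ} {x y : ℝ → ℝ}

lemma IsAvgTrajectory.comp_mul (hx : IsAvgTrajectory h δ γ x) {κ : ℝ} (hκ : 0 ≤ κ) :
    IsAvgTrajectory h δ (γ * κ) fun t => x (κ * t) := by
  intro t ht
  have h1 : HasDerivWithinAt (fun t => κ * t) κ (Ici 0) t := by
    simpa using ((hasDerivAt_id t).const_mul κ).hasDerivWithinAt
  have h2 := (hx (κ * t) (mul_nonneg hκ ht)).scomp t h1 fun s hs => mul_nonneg hκ hs
  refine h2.congr_deriv ?_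
  rw [smul_eq_mul]
  ring

lemma IsHPFAvgTrajectory.comp_mul (hxy : IsHPFAvgTrajectory h δ γ x y) {κ : ℝ} (hκ : 0 ≤ κ) :
    IsHPFAvgTrajectory h δ (γ * κ) (fun t => x (κ * t)) fun t => y (κ * t) := by
  refine ⟨hxy.1.comp_mul hκ, fun t ht => ?_⟩
  have h1 : HasDerivWithinAt (fun t => κ * t) κ (Ici 0) t := by
    simpa using ((hasDerivAt_id t).const_mul κ).hasDerivWithinAt
  have h2 := (hxy.2 (κ * t) (mul_nonneg hκ ht)).scomp t h1 fun s hs => mul_nonneg hκ hs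
  refine h2.congr_deriv ?_
  rw [smul_eq_mul]
  ring

lemma IsHPFAvgTrajectory.comp_const_add (hxy : IsHPFAvgTrajectory h δ γ x y) {s : ℝ}
    (hs : 0 ≤ s) : IsHPFAvgTrajectory h δ γ (fun t => x (s + t)) fun t => y (s + t) :=
  ⟨fun t ht => hasDerivWithinAt_comp_const_add hs (hxy.1 (s + t) (add_nonneg hs ht)),
    fun t ht => hasDerivWithinAt_comp_const_add hs (hxy.2 (s + t) (add_nonneg hs ht))⟩

lemma exists_lipschitz_sinCoeff_clamp (hh : ContDiff ℝ ∞ h) (hδ : 0 ≤ δ) {a b : ℝ} (hab : a ≤ b) :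
    ∃ K : ℝ≥0, LipschitzWith K fun x => sinCoeff h δ 1 (clamp a b x) / 2 := by
  obtain ⟨K, hK0, hK⟩ := exists_lipschitz_of_contDiff hh (a - δ) (b + δ)
  refine ⟨⟨K, hK0⟩, LipschitzWith.of_dist_le_mul fun u v => ?_⟩
  exact (abs_sinCoeff_sub_le hh.continuous hδ hK (clamp_mem hab u) (clamp_mem hab v)).trans
    (mul_le_mul_of_nonneg_left (abs_clamp_sub_le _ _ _ _) hK0)

lemma exists_bound_comp_clamp {f : ℝ → ℝ} (hf : Continuous f) {a b : ℝ} (hab : a ≤ b) :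
    ∃ C : ℝ≥0, ∀ x, ‖f (clamp a b x)‖ ≤ C := by
  obtain ⟨C, hC⟩ := isCompact_Icc.exists_bound_of_continuousOn (hf.continuousOn (s := Icc a b))
  exact ⟨Real.toNNReal C, fun x => (hC _ (clamp_mem hab x)).trans (Real.le_coe_toNNReal C)⟩

lemma PointsInward.exists_avgTrajectory (hp : PointsInward h xs δ c) (hh : ContDiff ℝ ∞ h)
    (hδ : 0 ≤ δ) (x₀ : ℝ) : ∃ x, IsAvgTrajectory h δ 1 x ∧ x 0 = x₀ := by
  set R := max δ |x₀ - xs| with hR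
  have hδR : δ ≤ R := le_max_left _ _
  have hab : xs - R ≤ xs + R := by linarith
  obtain ⟨K, hK⟩ := exists_lipschitz_sinCoeff_clamp hh hδ hab
  obtain ⟨C, hC⟩ := exists_bound_comp_clamp (continuous_sinCoeff_one hh.continuous δ) hab
  obtain ⟨x, hx0, hx⟩ := exists_solution_of_bounded_lipschitz
    (f := fun _ x => -(sinCoeff h δ 1 (clamp (xs - R) (xs + R) x) / 2)) (fun _ => hK.neg)
    (fun _ => continuous_const) (fun _ x => by rw [norm_neg]; exact hC x) x₀
  have hb := abs_le.1 (le_max_right δ |x₀ - xs|)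
  have hup : ∀ t, 0 ≤ t → x t ≤ xs + R := fun t ht =>
    le_of_deriv_neg le_rfl hx (by rw [hx0]; linarith) (fun s _ hs => by
      rw [hs, clamp_of_mem ⟨hab, le_rfl⟩]
      linarith [hp.right (xs + R) (by linarith), hp.pos]) ht
  have hlow : ∀ t, 0 ≤ t → xs - R ≤ x t := fun t ht =>
    ge_of_deriv_pos le_rfl hx (by rw [hx0]; linarith) (fun s _ hs => by
      rw [hs, clamp_of_mem ⟨le_rfl, hab⟩]
      linarith [hp.left (xs - R) (by linarith), hp.pos]) ht
  refine ⟨x, fun t ht => ?_, hx0⟩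
  have := hx t ht
  rw [clamp_of_mem ⟨hlow t ht, hup t ht⟩] at this
  exact this.congr_deriv (by ring)

lemma PointsInward.exists_HPFAvgTrajectory (hp : PointsInward h xs δ c) (hh : ContDiff ℝ ∞ h)
    (hδ : 0 ≤ δ) (x₀ y₀ : ℝ) :
    ∃ x y, IsHPFAvgTrajectory h δ 1 x y ∧ x 0 = x₀ ∧ y 0 = y₀ := by
  obtain ⟨x, hx, hx0⟩ := hp.exists_avgTrajectory hh hδ x₀
  obtain ⟨y, hy0, hy⟩ := exists_linear_filter
    ((continuous_cosCoeff_zero hh.continuous δ).comp_continuousOn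
      (continuousOn_of_hasDerivWithinAt hx)) y₀
  exact ⟨x, y, ⟨hx, fun t ht => (hy t ht).congr_deriv (by simp)⟩, hx0, hy0⟩

end Existence

/-! ### Attraction to the interval around the minimiser -/

lemma infDist_Icc_le_iff {xs δ D x : ℝ} (hδ : 0 ≤ δ) (hD : 0 ≤ D) :
    Metric.infDist x (Icc (xs - δ) (xs + δ)) ≤ D ↔ |x - xs| ≤ δ + D := by
  have hne : (Icc (xs - δ) (xs + δ)).Nonempty := ⟨xs, by linarith, by linarith⟩
  constructor
  · intro hle
    obtain ⟨z, hz, hzd⟩ := isCompact_Icc.exists_infDist_eq_dist hne x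
    rw [hzd, Real.dist_eq] at hle
    have := abs_le.1 hle
    exact abs_le.2 ⟨by linarith [hz.1], by linarith [hz.2]⟩
  · intro hle
    have h1 := abs_le.1 hle
    refine (Metric.infDist_le_dist_of_mem (clamp_mem (by linarith) x)).trans ?_
    rw [Real.dist_eq, abs_le, neg_le_sub_iff_le_add, sub_le_comm]
    exact ⟨max_le (by linarith) ((min_le_right _ _).trans (by linarith)),
      le_max_of_le_right (le_min (by linarith) (by linarith))⟩

lemma IsAvgTrajectory.abs_sub_le_of_speed {h : ℝ → ℝ} {xs δ c : ℝ} {x : ℝ → ℝ}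
    (hx : IsAvgTrajectory h δ 1 x) (hp : PointsInward h xs δ c) {D t : ℝ} (hD : 0 ≤ D)
    (h0 : |x 0 - xs| ≤ δ + D) (ht : 0 ≤ t) : |x t - xs| ≤ δ + max (D - c / 2 * t) 0 := by
  have hc := hp.pos
  have h0' := abs_le.1 h0
  have hline : ∀ s ∈ Icc (0 : ℝ) (D / (c / 2)), |x s - xs| ≤ δ + (D - c / 2 * s) := by
    intro s hs
    have hmem : ∀ u ∈ Ico (0 : ℝ) (D / (c / 2)), 0 ≤ D - c / 2 * u := fun u hu => by
      have := (le_div_iff₀ (by positivity)).1 hu.2.le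
      linarith
    have h1 := le_sub_mul_of_deriv_lt (c := xs + δ + D) (k := c / 2) le_rfl hx (by linarith)
      (fun u hu he => by
        have := hp.right (x u) (by linarith [hmem u hu])
        linarith) hs
    have h2 := le_sub_mul_of_deriv_lt (x := fun t => -x t) (c := -(xs - δ - D)) (k := c / 2) le_rfl
      (fun t ht => (hx t ht).neg) (by linarith)
      (fun u hu he => by
        have := hp.left (x u) (by linarith [hmem u hu])
        linarith) hs
    exact abs_le.2 ⟨by linarith, by linarith⟩
  rcases le_total t (D / (c / 2)) with hle | hle
  · exact (hline t ⟨ht, hle⟩).trans (by gcongr; exact le_max_left _ _)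
  · have hT : 0 ≤ D / (c / 2) := by positivity
    have h1 := hline _ ⟨hT, le_rfl⟩
    rw [mul_div_cancel₀ _ (by positivity), sub_self, add_zero] at h1
    have h2 := abs_le.1 h1
    have hup := hx.le_add hp one_pos le_rfl hT (by linarith) hle
    have hlow := hx.sub_le hp one_pos le_rfl hT (by linarith) hle
    refine (abs_le.2 ⟨by linarith, by linarith⟩ : |x t - xs| ≤ δ).trans ?_
    linarith [le_max_right (D - c / 2 * t) 0]

lemma IsAvgTrajectory.infDist_le {h : ℝ → ℝ} {xs δ c : ℝ} {x : ℝ → ℝ}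
    (hx : IsAvgTrajectory h δ 1 x) (hp : PointsInward h xs δ c) (hδ : 0 ≤ δ) {D t : ℝ}
    (hD : 0 ≤ D) (h0 : Metric.infDist (x 0) (Icc (xs - δ) (xs + δ)) ≤ D) (ht : 0 ≤ t) :
    Metric.infDist (x t) (Icc (xs - δ) (xs + δ)) ≤ entryEstimate (c / 2) D t := by
  refine le_trans ((infDist_Icc_le_iff hδ (le_max_right _ _)).2
    (hx.abs_sub_le_of_speed hp hD ((infDist_Icc_le_iff hδ hD).1 h0) ht))
    (sub_le_entryEstimate (by have := hp.pos; positivity) hD ht)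

/-! ### Attraction to the invariant graph -/

lemma abs_apply_sub_le_dist (p q : EuclideanSpace ℝ (Fin 2)) (i : Fin 2) :
    |p i - q i| ≤ dist p q := by
  rw [dist_eq_norm]
  exact PiLp.norm_apply_le (p - q) i

section Graph

variable {h : ℝ → ℝ} {xs δ c : ℝ} {τ : ℝ → ℝ}

/-- A continuous function, constant outside `[xs - δ, xs + δ]`, whose graph over that interval
attracts at unit rate every trajectory of the average system that has entered the strip. -/
lemma PointsInward.exists_attracting_graph (hp : PointsInward h xs δ c) (hh : ContDiff ℝ ∞ h)
    (hδ : 0 ≤ δ) : ∃ τ : ℝ → ℝ, Continuous τ ∧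
      (∀ x, τ (clamp (xs - δ) (xs + δ) x) = τ x) ∧
      ∀ x y, IsHPFAvgTrajectory h δ 1 x y → |x 0 - xs| ≤ δ → ∀ t, 0 ≤ t →
        y t - τ (x t) = Real.exp (-t) * (y 0 - τ (x 0)) := by
  have hab : xs - δ ≤ xs + δ := by linarith
  obtain ⟨K, hK⟩ := exists_lipschitz_sinCoeff_clamp hh hδ hab
  obtain ⟨C, hC⟩ := exists_bound_comp_clamp (continuous_sinCoeff_one hh.continuous δ) hab
  have hac := continuous_cosCoeff_zero hh.continuous δ
  obtain ⟨B, hB⟩ := exists_bound_comp_clamp hac hab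
  obtain ⟨τ, hτc, hτ⟩ := exists_invariant_graph hK hC (hac.comp (continuous_clamp _ _)) hB
  refine ⟨fun x => τ (clamp (xs - δ) (xs + δ) x), hτc.comp (continuous_clamp _ _), fun x => ?_,
    fun x y hxy h0 t ht => ?_⟩
  · simp only [clamp_of_mem (clamp_mem hab x)]
  · have hin : ∀ s, 0 ≤ s → clamp (xs - δ) (xs + δ) (x s) = x s := fun s hs => by
      have := abs_le.1 (hxy.1.abs_sub_le hp one_pos le_rfl h0 hs)
      exact clamp_of_mem ⟨by linarith, by linarith⟩
    have h1 := hτ x (fun s hs => by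
      rw [hin s hs]
      exact (hxy.1 s hs).congr_deriv (by ring)) t ht
    have h2 := eq_of_linear_filter (A := fun s => cosCoeff h δ 0 (x s) / 2)
      (hac.comp_continuousOn (continuousOn_of_hasDerivWithinAt hxy.1))
      (fun s hs => (hxy.2 s hs).congr_deriv (by ring)) ht
    have h3 : ∫ s in (0 : ℝ)..t, Real.exp s *
          ((fun x => cosCoeff h δ 0 x / 2) ∘ clamp (xs - δ) (xs + δ)) (x s) =
        ∫ s in (0 : ℝ)..t, Real.exp s * (cosCoeff h δ 0 (x s) / 2) := by
      refine intervalIntegral.integral_congr fun s hs => ?_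
      rw [uIcc_of_le ht] at hs
      simp only [Function.comp_apply, hin s hs.1]
    simp only
    rw [hin t ht, hin 0 le_rfl, h1, h2, h3]
    ring

/-- The deviation of the filter state from the graph, multiplied by `exp t`, in terms of the
modulus of continuity of `τ` at a scale proportional to the initial distance `D` to the graph.
The strip is entered before time `2 * D / c`; until then both components move at bounded speed. -/
lemma PointsInward.exists_deviation_bound (hp : PointsInward h xs δ c) (hh : Continuous h)
    (hδ : 0 ≤ δ) (hτc : Continuous τ)
    (hτ : ∀ x y, IsHPFAvgTrajectory h δ 1 x y → |x 0 - xs| ≤ δ → ∀ t, 0 ≤ t →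
      y t - τ (x t) = Real.exp (-t) * (y 0 - τ (x 0))) (R : ℝ) (hR : 0 ≤ R) :
    ∃ E Q : ℝ, 0 < E ∧ 0 < Q ∧ ∀ x y, IsHPFAvgTrajectory h δ 1 x y → ∀ D, 0 ≤ D → D ≤ R →
      Metric.infDist !₂[x 0, y 0] (graphOver τ (Icc (xs - δ) (xs + δ))) ≤ D → ∀ ε : ℝ,
      (∀ u v, |u - v| ≤ Q * D → |τ u - τ v| ≤ ε) → ∀ t, 0 ≤ t →
        Real.exp t * |y t - τ (x t)| ≤ E * (Q * D + 2 * ε) := by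
  set S := Icc (xs - δ) (xs + δ) with hSdef
  have hSne : S.Nonempty := ⟨xs, by simp only [hSdef, mem_Icc]; constructor <;> linarith⟩
  obtain ⟨G, hG⟩ := isCompact_Icc.exists_bound_of_continuousOn
    ((continuous_sinCoeff_one hh δ).continuousOn (s := Icc (xs - (δ + R)) (xs + (δ + R))))
  obtain ⟨A, hA⟩ := isCompact_Icc.exists_bound_of_continuousOn
    ((continuous_cosCoeff_zero hh δ).continuousOn (s := Icc (xs - (δ + R)) (xs + (δ + R))))
  obtain ⟨B, hB⟩ := isCompact_Icc.exists_bound_of_continuousOn (hτc.continuousOn (s := S))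
  have hxsm : xs ∈ Icc (xs - (δ + R)) (xs + (δ + R)) := ⟨by linarith, by linarith⟩
  have hG0 : 0 ≤ G := (norm_nonneg _).trans (hG xs hxsm)
  have hA0 : 0 ≤ A := (norm_nonneg _).trans (hA xs hxsm)
  have hB0 : 0 ≤ B := by
    obtain ⟨z, hz⟩ := hSne
    exact (norm_nonneg _).trans (hB z hz)
  set k := c / 2 with hk
  have hk0 : 0 < k := half_pos hp.pos
  set Y := B + R + A + 1 with hY
  have hY0 : 0 ≤ Y := by positivity
  refine ⟨Real.exp (R / k), 1 + G / k + (Y + A) / k, Real.exp_pos _, by positivity,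
    fun x y hxy D hD hDR hdist ε hε t ht => ?_⟩
  set Q := 1 + G / k + (Y + A) / k with hQ
  have hQ1 : 1 ≤ Q := by
    have h1 : 0 ≤ G / k := by positivity
    have h2 : 0 ≤ (Y + A) / k := by positivity
    linarith
  have hQG : G / k ≤ Q := by
    have h2 : 0 ≤ (Y + A) / k := by positivity
    linarith
  obtain ⟨z₀, hz₀⟩ := hSne
  obtain ⟨p, hpG, hpd⟩ := (isClosed_graphOver hτc isClosed_Icc).exists_infDist_eq_dist
    ⟨_, pair_mem_graphOver hz₀⟩ !₂[x 0, y 0]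
  rw [hpd] at hdist
  have hx0p : |x 0 - p 0| ≤ D := (abs_apply_sub_le_dist !₂[x 0, y 0] p 0).trans hdist
  have hy0p : |y 0 - τ (p 0)| ≤ D := by
    rw [← hpG.2]
    exact (abs_apply_sub_le_dist !₂[x 0, y 0] p 1).trans hdist
  have hx0 : |x 0 - xs| ≤ δ + D := by
    have h1 := abs_le.1 hx0p
    exact abs_le.2 ⟨by linarith [hpG.1.1], by linarith [hpG.1.2]⟩
  have hxt : ∀ s, 0 ≤ s → |x s - xs| ≤ δ + max (D - k * s) 0 := fun s hs =>
    hxy.1.abs_sub_le_of_speed hp hD hx0 hs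
  have hxR : ∀ s, 0 ≤ s → x s ∈ Icc (xs - (δ + R)) (xs + (δ + R)) := fun s hs => by
    have h1 : max (D - k * s) 0 ≤ R := max_le (by nlinarith) hR
    have h2 := abs_le.1 (hxt s hs)
    constructor <;> linarith
  have hxl : ∀ s, 0 ≤ s → |x s - x 0| ≤ G * s := fun s hs => by
    have := abs_sub_le_of_deriv_le (C := G) hxy.1 (fun u hu => by
      rw [neg_one_mul, abs_neg]
      exact hG _ (hxR u hu)) le_rfl hs
    rwa [sub_zero, abs_of_nonneg hs] at this
  have hyY : ∀ s, 0 ≤ s → |y s| ≤ Y := by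
    intro s hs
    have h1 := abs_le.1 hy0p
    have h2 := abs_le.1 (hB _ hpG.1)
    have hup := le_of_deriv_neg (c := Y) le_rfl hxy.2 (by linarith) (fun u hu he => by
      have := abs_le.1 (hA _ (hxR u hu))
      linarith) hs
    have hlow := ge_of_deriv_pos (c := -Y) le_rfl hxy.2 (by linarith) (fun u hu he => by
      have := abs_le.1 (hA _ (hxR u hu))
      linarith) hs
    exact abs_le.2 ⟨hlow, hup⟩
  have hyl : ∀ s, 0 ≤ s → |y s - y 0| ≤ (Y + A) * s := fun s hs => by
    have := abs_sub_le_of_deriv_le (C := Y + A) hxy.2 (fun u hu => by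
      have h1 := abs_le.1 (hyY u hu)
      have h2 := abs_le.1 (hA _ (hxR u hu))
      exact abs_le.2 ⟨by linarith, by linarith⟩) le_rfl hs
    rwa [sub_zero, abs_of_nonneg hs] at this
  have ht₀ : 0 ≤ D / k := div_nonneg hD hk0.le
  have early : ∀ s, 0 ≤ s → s ≤ D / k → |y s - τ (x s)| ≤ Q * D + 2 * ε := by
    intro s hs hst
    have h1 : |y s - y 0| ≤ (Y + A) / k * D :=
      (hyl s hs).trans ((mul_le_mul_of_nonneg_left hst (by positivity)).trans_eq (by ring))
    have h2 : |τ (p 0) - τ (x 0)| ≤ ε := hε _ _ (by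
      rw [abs_sub_comm]
      nlinarith)
    have h3 : |τ (x 0) - τ (x s)| ≤ ε := hε _ _ (by
      rw [abs_sub_comm]
      refine (hxl s hs).trans ((mul_le_mul_of_nonneg_left hst hG0).trans ?_)
      rw [mul_div_left_comm, mul_comm]
      exact mul_le_mul_of_nonneg_right hQG hD)
    have h4 : 0 ≤ G / k * D := by positivity
    have h5 : y s - τ (x s) = (y s - y 0) + (y 0 - τ (p 0)) + (τ (p 0) - τ (x 0)) +
      (τ (x 0) - τ (x s)) := by ring
    have h6 : Q * D = D + G / k * D + (Y + A) / k * D := by rw [hQ]; ring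
    have h7 := abs_le.1 h1
    have h8 := abs_le.1 h2
    have h9 := abs_le.1 h3
    have h10 := abs_le.1 hy0p
    rw [h5, h6]
    exact abs_le.2 ⟨by linarith, by linarith⟩
  have hDR' : D / k ≤ R / k := div_le_div_of_nonneg_right hDR hk0.le
  rcases le_total t (D / k) with hle | hle
  · exact mul_le_mul (Real.exp_le_exp.2 (hle.trans hDR')) (early t ht hle) (abs_nonneg _)
      (Real.exp_pos _).le
  · have hin : |x (D / k) - xs| ≤ δ := by
      have := hxt _ ht₀
      rwa [mul_div_cancel₀ _ hk0.ne', sub_self, max_self, add_zero] at this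
    have h1 := hτ _ _ (hxy.comp_const_add ht₀) (by simpa using hin) (t - D / k) (sub_nonneg.2 hle)
    simp only [add_sub_cancel, add_zero] at h1
    rw [h1, abs_mul, abs_of_pos (Real.exp_pos _), ← mul_assoc, ← Real.exp_add, neg_sub,
      add_sub_cancel]
    exact mul_le_mul (Real.exp_le_exp.2 hDR') (early _ ht₀ le_rfl) (abs_nonneg _)
      (Real.exp_pos _).le

/-- **Existence of an averaged attractor**: the interval `[xs - δ, xs + δ]` together with its
invariant graph. -/
theorem PointsInward.exists_isAvgAttractor (hp : PointsInward h xs δ c) (hh : ContDiff ℝ ∞ h)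
    (hδ : 0 ≤ δ) : ∃ (S : Set ℝ) (τ : ℝ → ℝ) (β βg : ℝ → ℝ → ℝ),
      IsClassKL β ∧ IsClassKInfty (fun s => β s 0) ∧ IsClassKL βg ∧
      IsAvgAttractor h xs δ S τ β βg := by
  have hab : xs - δ ≤ xs + δ := by linarith
  have hc2 : 0 < c / 2 := half_pos hp.pos
  set S := Icc (xs - δ) (xs + δ) with hS
  have hSne : S.Nonempty := ⟨_, clamp_mem hab xs⟩
  obtain ⟨τ, hτc, hτcl, hτ⟩ := hp.exists_attracting_graph hh hδ
  set D : EuclideanSpace ℝ (Fin 2) → ℝ := fun p => Metric.infDist p (graphOver τ S) with hD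
  obtain ⟨B, hB⟩ := exists_bound_comp_clamp hτc hab
  simp only [hτcl] at hB
  have huc : UniformContinuous τ := by
    have h1 : UniformContinuousOn τ S := isCompact_Icc.uniformContinuousOn_of_continuous
      hτc.continuousOn
    rw [Metric.uniformContinuousOn_iff] at h1
    rw [Metric.uniformContinuous_iff]
    intro ε hε
    obtain ⟨η, hη, h2⟩ := h1 ε hε
    refine ⟨η, hη, fun {u v} huv => ?_⟩
    rw [← hτcl u, ← hτcl v]
    exact h2 _ (clamp_mem hab u) _ (clamp_mem hab v) ((abs_clamp_sub_le _ _ _ _).trans_lt huv)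
  -- The deviation from the graph decays like `exp (-t)`, with a factor dominated uniformly over all
  -- trajectories.
  let ι := {q : (ℝ → ℝ) × (ℝ → ℝ) × ℝ // IsHPFAvgTrajectory h δ 1 q.1 q.2.1 ∧ 0 ≤ q.2.2}
  obtain ⟨W, hW, hVW⟩ := exists_classK_majorant (ι := ι)
    (V := fun q => Real.exp q.1.2.2 * |q.1.2.1 q.1.2.2 - τ (q.1.1 q.1.2.2)|)
    (D := fun q => D !₂[q.1.1 0, q.1.2.1 0]) (fun q => Metric.infDist_nonneg)
    (fun R => by
      obtain ⟨E, Q, hE, hQ, hEQ⟩ := hp.exists_deviation_bound hh.continuous hδ hτc hτ (max R 0)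
        (le_max_right _ _)
      refine ⟨E * (Q * max R 0 + 2 * (2 * B)), fun q hq => ?_⟩
      refine hEQ _ _ q.2.1 (max R 0) (le_max_right _ _) le_rfl (hq.trans (le_max_left _ _)) (2 * B)
        (fun u v _ => ?_) _ q.2.2
      exact (abs_sub _ _).trans (by
        have h1 := hB u
        have h2 := hB v
        rw [Real.norm_eq_abs] at h1 h2
        linarith))
    (fun ε hε => by
      obtain ⟨E, Q, hE, hQ, hEQ⟩ := hp.exists_deviation_bound hh.continuous hδ hτc hτ 1
        zero_le_one
      obtain ⟨η, hη, hητ⟩ := Metric.uniformContinuous_iff.1 huc (ε / (3 * E)) (by positivity)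
      refine ⟨min 1 (min (η / (2 * Q)) (ε / (3 * E * Q))), by positivity, fun q hq => ?_⟩
      set D₀ := min 1 (min (η / (2 * Q)) (ε / (3 * E * Q))) with hD₀
      have hD0 : 0 ≤ D₀ := by positivity
      have h1 : Q * D₀ ≤ η / 2 := by
        have : D₀ ≤ η / (2 * Q) := (min_le_right _ _).trans (min_le_left _ _)
        calc Q * D₀ ≤ Q * (η / (2 * Q)) := mul_le_mul_of_nonneg_left this hQ.le
          _ = η / 2 := by field_simp
      have h2 : E * (Q * D₀) ≤ ε / 3 := by
        have : D₀ ≤ ε / (3 * E * Q) := (min_le_right _ _).trans (min_le_right _ _)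
        calc E * (Q * D₀) ≤ E * (Q * (ε / (3 * E * Q))) := by gcongr
          _ = ε / 3 := by field_simp
      have h3 := hEQ _ _ q.2.1 D₀ hD0 (min_le_left _ _) hq (ε / (3 * E))
        (fun u v huv => (hητ (show dist u v < η by rw [Real.dist_eq]; linarith)).le) _ q.2.2
      refine h3.trans ?_
      calc E * (Q * D₀ + 2 * (ε / (3 * E))) = E * (Q * D₀) + 2 * (ε / 3) := by field_simp
        _ ≤ ε := by linarith)
  refine ⟨S, τ, entryEstimate (c / 2), fun s t => entryEstimate (c / 2) s t + Real.exp (-t) * W s,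
    isClassKL_entryEstimate hc2, isClassKInfty_entryEstimate_zero _,
    (isClassKL_entryEstimate hc2).add_exp_mul hW, isCompact_Icc, hSne, subset_rfl, hτc, ?_, ?_⟩
  · refine fun γ hγ => ⟨fun x₀ => ?_, fun x hx t ht => ?_⟩
    · obtain ⟨x, hx, hx0⟩ := hp.exists_avgTrajectory hh hδ x₀
      exact ⟨_, by simpa using hx.comp_mul hγ.le, by simpa using hx0⟩
    · have h1 : IsAvgTrajectory h δ 1 fun t => x (γ⁻¹ * t) := by
        simpa [mul_inv_cancel₀ hγ.ne'] using hx.comp_mul (inv_nonneg.2 hγ.le)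
      have h2 := h1.infDist_le hp hδ Metric.infDist_nonneg le_rfl (mul_nonneg hγ.le ht)
      simpa [inv_mul_cancel_left₀ hγ.ne'] using h2
  · refine fun γ hγ => ⟨fun x₀ y₀ => ?_, fun x y hxy t ht => ?_⟩
    · obtain ⟨x, y, hxy, hx0, hy0⟩ := hp.exists_HPFAvgTrajectory hh hδ x₀ y₀
      exact ⟨_, _, by simpa using hxy.comp_mul hγ.le, by simpa using hx0, by simpa using hy0⟩
    · have h1 : IsHPFAvgTrajectory h δ 1 (fun t => x (γ⁻¹ * t)) fun t => y (γ⁻¹ * t) := by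
        simpa [mul_inv_cancel₀ hγ.ne'] using hxy.comp_mul (inv_nonneg.2 hγ.le)
      have ht' : 0 ≤ γ * t := mul_nonneg hγ.le ht
      have hx0 : Metric.infDist (x 0) S ≤ D !₂[x 0, y 0] := by
        obtain ⟨p, hpG, hpd⟩ := (isClosed_graphOver hτc isClosed_Icc).exists_infDist_eq_dist
          (hSne.elim fun z hz => ⟨_, pair_mem_graphOver hz⟩) !₂[x 0, y 0]
        simp only [hD]
        rw [hpd]
        exact (Metric.infDist_le_dist_of_mem hpG.1).trans (abs_apply_sub_le_dist !₂[x 0, y 0] p 0)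
      have h2 := h1.1.infDist_le hp hδ (D := D !₂[x 0, y 0]) Metric.infDist_nonneg
        (by simpa using hx0) ht'
      have h3 := hVW ⟨(_, _, γ * t), h1, ht'⟩
      simp only [inv_mul_cancel_left₀ hγ.ne', mul_zero] at h2 h3
      have hcl : |x t - clamp (xs - δ) (xs + δ) (x t)| ≤ Metric.infDist (x t) S :=
        (Metric.le_infDist hSne).2 fun z hz => abs_sub_clamp_le hz (x t)
      have h4 : |y t - τ (x t)| ≤ Real.exp (-(γ * t)) * W (D !₂[x 0, y 0]) := by
        rw [Real.exp_neg, ← div_eq_inv_mul, le_div_iff₀' (Real.exp_pos _)]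
        exact h3
      refine (Metric.infDist_le_dist_of_mem
        (pair_mem_graphOver (clamp_mem hab (x t)))).trans ((dist_pair_le _ _ _ _).trans ?_)
      rw [hτcl]
      exact add_le_add (hcl.trans h2) h4

end Graph

end ExtremumSeeking

open ExtremumSeeking in
theorem theorem1 (r δ d : ℝ) (hr : 0 < r) (hδ : 0 < δ) (hd : 0 < d) (hrd : 0 < r - d - 2 * δ) :
    (∀ (h : ℝ → ℝ) (xs : ℝ) (m α : ℝ → ℝ) (A b : ℝ),
      SmoothWithStrictMinimiser h xs → HasQuasiConvexEnvelope h xs m α A →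
      0 < b → A + b ≤ deltaStar α δ →
      ∃ (S : Set ℝ) (τ : ℝ → ℝ) (β βg : ℝ → ℝ → ℝ),
        IsClassKL β ∧ IsClassKInfty (fun s => β s 0) ∧ IsClassKL βg ∧
        IsAvgAttractor h xs δ S τ β βg) ∧
    (∀ (L : ℝ) (β βg : ℝ → ℝ → ℝ), 0 < L →
      IsClassKL β → IsClassKInfty (fun s => β s 0) → IsClassKL βg →
      ∃ tbar γs : ℝ, 0 < tbar ∧ 0 < γs ∧
        ∀ (h : ℝ → ℝ) (xs : ℝ) (m α : ℝ → ℝ) (A b : ℝ) (S : Set ℝ) (τ : ℝ → ℝ),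
          SmoothWithStrictMinimiser h xs → HasQuasiConvexEnvelope h xs m α A →
          0 < b → A + b ≤ deltaStar α δ →
          (∀ x₁ ∈ Set.Icc (xs - r) (xs + r), ∀ x₂ ∈ Set.Icc (xs - r) (xs + r),
            |h x₁ - h x₂| ≤ L * |x₁ - x₂|) →
          IsAvgAttractor h xs δ S τ β βg →
          ∀ γ : ℝ, 0 < γ → γ < γs → ∀ x₀ y₀ : ℝ,
            |x₀ - xs| ≤ chi β (r - d - 2 * δ) → |y₀ - cosCoeff h δ 0 x₀ / 2| ≤ γs →
            (∃ x y : ℝ → ℝ, IsHPFTrajectory h δ γ x y ∧ x 0 = x₀ ∧ y 0 = y₀) ∧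
            ∀ x y : ℝ → ℝ, IsHPFTrajectory h δ γ x y → x 0 = x₀ → y 0 = y₀ →
              (∃ C : ℝ, ∀ t, 0 ≤ t → |x t| ≤ C ∧ |y t| ≤ C) ∧
              ∀ t, tbar / γ ≤ t → Metric.infDist !₂[x t, y t] (graphOver τ S) ≤ d) := by
  refine ⟨fun h xs m α A b hh hm hb0 hb => ?_, fun L β βg hL hβ hβ0 hβg => ?_⟩
  · exact (hm.pointsInward hh hδ.le hb0 hb).exists_isAvgAttractor hh.smooth hδ.le
  · obtain ⟨tbar, γs, htbar, hγs, H⟩ := practical_stability hδ hd hrd hL hβ hβ0 hβg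
    exact ⟨tbar, γs, htbar, hγs, fun h xs m α A b S τ hh hm hb0 hb hl hS =>
      H h xs _ S τ hh.smooth (hm.pointsInward hh hδ.le hb0 hb) hl hS⟩
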